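/- Consider the rank-$4$ tensorial group field theory on $\mathrm U(1)$ with closure constraint and covariance slices $$C_i(\theta;\theta')=\int_{s_i}d\alpha\,e^{-m^2\alpha}\int dh\prod_{\ell=1}^4K_\alpha(\theta_\ell+h-\theta'_\ell),\qquad s_0=[1,\infty),\quad s_i=[M^{-2i},M^{-2(i-1)}]\ (i\ge1),$$ where $M>1$, $m>0$, $K_\alpha$ is the heat kernel of $\mathrm U(1)$ and $dh$ is the normalized Haar measure. A Feynman graph $\mathcal G$ is a finite bipartite graph with white and black nodes, in which each of the colours $1,\dots,4$ is a perfect matching and the colour $0$ is a partial matching. Its $L(\mathcal G)$ lines are the edges of colour $0$. Its external legs are the nodes without line. Its vertices ($4$-bubbles) are the connected components left after removing the colour $0$. Its faces of colour $\ell$ are the connected components of the part made of the colours $0$ and $\ell$. A face is open if it contains an external leg, and closed otherwise. Each external leg carries one boundary angle for each colour. For a scale attribution $\mu=(i_e)_e\in\mathbb N^{L(\mathcal G)}$, the amplitude is the distribution in the boundary angles $$\mathcal A_{\mathcal G,\mu}=\Big[\prod_{e}\int_{s_{i_e}}d\alpha_e\,e^{-m^2\alpha_e}\int dh_e\Big]\prod_{f\text{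 closed}}K_{\alpha(f)}\Big(\sum_{e\in f}h_e\Big)\prod_{f\text{ open}}K_{\alpha(f)}\Big(\theta_{s(f)}+\sum_{e\in f}h_e-\theta_{t(f)}\Big),$$ where lines are oriented from white to black, $\alpha(f)=\sum_{e\in f}\alpha_e$, $\theta_{s(f)},\theta_{t(f)}$ are the boundary angles at the black and the white end of $f$, and $K_0=\delta$. A subgraph is a set $\mathcal H$ of lines. Its internal faces are the closed faces of $\mathcal G$ that pass only through lines of $\mathcal H$. It is connected if it is nonempty and its incidence matrix between lines and internal faces does not factorize into several blocks. Contracting a line with ends $w,b$ means deleting $w$, $b$ and the edges joining them, and joining, in each remaining colour, the former neighbours of $w$ and $b$. A melopole is a connected subgraph, all of whose lines have both ends on one and the same bubble, that admits an ordering of its lines such that the two ends of each line, after contraction of the preceding lines, are joined by at least three edges of colours $1,\dots,4$. **Proposition.** Let $M>1$, $m>0$ and $p\in\mathbb N$. There is $K>0$ such that for every connected non-vacuum graph $\mathcal G$ (i.e. with at least one external leg) that has no melopole and whose bubbles have at most $p$ nodes, and for every measurable function $u$ of the boundary angles with $|u|\le1$, the integrals defining $\mathcal A_{\mathcal G,\mu}(u)$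 (paired with the normalized measure of the boundary angles) converge absolutely for every $\mu$, the sum over $\mu$ converges absolutely, and $$\sum_{\mu}|\mathcal A_{\mathcal G,\mu}(u)|\le K^{L(\mathcal G)}.$$ In particular ($u=1$) this holds for the amputated amplitudes, in which the open faces are discarded. -/

import Mathlib

open MeasureTheory

noncomputable section

/-- A Feynman graph of the rank-4 model, given by its 5-coloured extension.
`W`, `B` are the white and black nodes (fields `φ`, `φ̄`), `L` is the set of (internal) lines.
Each colour `ℓ` gives a perfect matching of white with black nodes (the colored lines);
the lines, of colour 0, form a partial matching. Nodes without a line are the external legs. -/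
structure TensorGraph (W B L : Type) where
  color : Fin 4 → W ≃ B
  whiteEnd : L ↪ W
  blackEnd : L ↪ B

namespace TensorGraph

variable {W B L : Type}

/-- `w` and `b` are joined by a line of the given colour; `none` is the colour 0. -/
def Joined (G : TensorGraph W B L) : Option (Fin 4) → W → B → Prop
  | none, w, b => ∃ e, G.whiteEnd e = w ∧ G.blackEnd e = b
  | some ℓ, w, b => G.color ℓ w = b

/-- The part of the coloured extension made of all nodes and of the lines with colour in `C`. -/
def coloredPart (G : TensorGraph W B L) (C : Set (Option (Fin 4))) : SimpleGraph (W ⊕ B) :=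
  SimpleGraph.fromRel fun x y =>
    ∃ k ∈ C, ∃ w b, x = Sum.inl w ∧ y = Sum.inr b ∧ G.Joined k w b

/-- `G` is connected (its coloured extension is). -/
def IsConnected (G : TensorGraph W B L) : Prop :=
  (G.coloredPart Set.univ).Connected

/-- The vertices of `G`: its 4-bubbles, the connected components left without colour 0. -/
abbrev Bubble (G : TensorGraph W B L) : Type :=
  (G.coloredPart {none}ᶜ).ConnectedComponent

/-- Every bubble of `G` has order (number of nodes) at most `p`. -/
def OrderLE (G : TensorGraph W B L) (p : ℕ) : Prop :=
  ∀ v : G.Bubble, v.supp.ncard ≤ p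

/-- White external legs. -/
abbrev ExtWhite (G : TensorGraph W B L) : Type := {w : W // w ∉ Set.range G.whiteEnd}

/-- Black external legs. -/
abbrev ExtBlack (G : TensorGraph W B L) : Type := {b : B // b ∉ Set.range G.blackEnd}

/-- A vacuum graph has no external leg. -/
def IsVacuum (G : TensorGraph W B L) : Prop :=
  IsEmpty G.ExtWhite ∧ IsEmpty G.ExtBlack

/-! ### Faces -/

/-- Faces, closed or open: the alternating circuits and paths of colours 0 and `ℓ`. -/
abbrev Face (G : TensorGraph W B L) : Type :=
  Σ ℓ : Fin 4, (G.coloredPart {none, some ℓ}).ConnectedComponent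

/-- A face is closed when no external leg lies on it. -/
def IsClosedFace (G : TensorGraph W B L) (f : G.Face) : Prop :=
  (∀ w : G.ExtWhite, Sum.inl w.1 ∉ f.2.supp) ∧ ∀ b : G.ExtBlack, Sum.inr b.1 ∉ f.2.supp

/-- The line `e` belongs to the boundary of the face `f`. If every line is oriented from its
white to its black end, then each face runs through all its lines in the same direction; with
the faces oriented accordingly, `ε_{ef}` is `1` if `e` is on `f` and `0` otherwise. -/
def OnFace (G : TensorGraph W B L) (e : L) (f : G.Face) : Prop :=
  Sum.inl (G.whiteEnd e) ∈ f.2.supp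

open Classical in
/-- The sum of `x e` over the lines `e` of the face `f`. -/
def faceSum [Fintype L] (G : TensorGraph W B L) (x : L → ℝ) (f : G.Face) : ℝ :=
  ∑ e with G.OnFace e f, x e

/-- The open face of colour `ℓ` that starts at the external leg `b`. -/
def openFace (G : TensorGraph W B L) (ℓ : Fin 4) (b : G.ExtBlack) : G.Face :=
  ⟨ℓ, (G.coloredPart {none, some ℓ}).connectedComponentMk (Sum.inr b.1)⟩

/-! ### Melopoles -/

/-- Internal faces of a subgraph `H` (a set of lines): the closed faces of `G` that pass only
through lines of `H` (and through at least one line, as every closed face does). -/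
def IsInternalFace (G : TensorGraph W B L) (H : Set L) (f : G.Face) : Prop :=
  G.IsClosedFace f ∧ ∀ e, G.OnFace e f → e ∈ H

/-- A subgraph is connected when the incidence matrix between its lines and its internal faces
does not factorize into several rectangular blocks. -/
def IsConnectedSubgraph (G : TensorGraph W B L) (H : Set L) : Prop :=
  H.Nonempty ∧ ∀ S ⊆ H, S.Nonempty →
    (∀ f, G.IsInternalFace H f →
      (∀ e, G.OnFace e f → e ∈ S) ∨ (∀ e, G.OnFace e f → e ∉ S)) → S = H

/-- With colored lines `c`, a line joining `w` to `b` is a `k`-dipole for this `k`. -/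
def dipoleOrder (c : Fin 4 → W ≃ B) (w : W) (b : B) : ℕ :=
  1 + {ℓ : Fin 4 | c ℓ w = b}.ncard

open Classical in
/-- Contraction of a line joining `w` to `b`: in each colour, the partner of `b` is reconnected
to the partner of `w`. Instead of being deleted, `w` and `b` are left as an isolated pair,
joined to each other in all colours. -/
def contractLine (c : Fin 4 → W ≃ B) (w : W) (b : B) : Fin 4 → W ≃ B :=
  fun ℓ => (c ℓ).trans (Equiv.swap b (c ℓ w))

/-- Along the list of lines, each line is a melonic dipole once its predecessors have been
contracted. The order is 4, except that it is 5 for the last line of a vacuum melopole. -/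
def IsHeppSector (G : TensorGraph W B L) : (Fin 4 → W ≃ B) → List L → Prop
  | _, [] => True
  | c, e :: es => 4 ≤ dipoleOrder c (G.whiteEnd e) (G.blackEnd e) ∧
      IsHeppSector G (contractLine c (G.whiteEnd e) (G.blackEnd e)) es

/-- A melopole: a (nonempty) connected single-vertex subgraph whose lines can be ordered so that
each of them is a melonic dipole after contraction of the previous ones. -/
def IsMelopole (G : TensorGraph W B L) (H : Set L) : Prop :=
  G.IsConnectedSubgraph H ∧
  (∃ v : G.Bubble, ∀ e ∈ H,
    Sum.inl (G.whiteEnd e) ∈ v.supp ∧ Sum.inr (G.blackEnd e) ∈ v.supp) ∧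
  ∃ l : List L, l.Nodup ∧ {e | e ∈ l} = H ∧ G.IsHeppSector G.color l

/-- Fully convergent graphs: those without melopole. -/
def FullyConvergent (G : TensorGraph W B L) : Prop :=
  ∀ H : Set L, ¬ G.IsMelopole H

end TensorGraph

/-! ### Amplitudes -/

/-- The heat kernel at time `α` on `U(1)`, in the angle coordinate, with respect to the normalized
Haar measure. -/
def heatKernel (α θ : ℝ) : ℝ :=
  √(Real.pi / α) * ∑' n : ℤ, Real.exp (-(θ - 2 * Real.pi * n) ^ 2 / (4 * α))

/-- Normalized Haar measure of `U(1)` in the angle coordinate `θ ∈ [0, 2π)`. -/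
def haarAngle : Measure ℝ :=
  (ENNReal.ofReal (2 * Real.pi))⁻¹ • volume.restrict (Set.Ico 0 (2 * Real.pi))

/-- The slice of Schwinger parameters of scale `i`: `[1, ∞)` for `i = 0`, and
`[M ^ (-2 i), M ^ (-2 (i - 1))]` for `i ≥ 1`. -/
def slice (M : ℝ) : ℕ → Set ℝ
  | 0 => Set.Ici 1
  | i + 1 => Set.Icc (M ^ (2 * (i + 1)))⁻¹ (M ^ (2 * i))⁻¹

namespace TensorGraph

variable {W B L : Type}

/-- Values of the boundary variables: one angle for each external leg and colour, first those of
the black legs (sources of the open faces), then those of the white legs (targets). -/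
abbrev Boundary (G : TensorGraph W B L) : Type :=
  (Fin 4 × G.ExtBlack → ℝ) × (Fin 4 × G.ExtWhite → ℝ)

/-- The integration variables `(α, (h, g))` of an amplitude. -/
abbrev Config (G : TensorGraph W B L) : Type :=
  (L → ℝ) × (L → ℝ) × G.Boundary

open Classical in
/-- An open face that contains no line has kernel `K_0`, a Dirac mass: it sets its target
variable equal to its source variable. -/
def identify (G : TensorGraph W B L) (g : G.Boundary) : G.Boundary :=
  (g.1, fun x =>
    if hx : G.color x.1 x.2.1 ∉ Set.range G.blackEnd
      then g.1 (x.1, ⟨G.color x.1 x.2.1, hx⟩) else g.2 x)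

open Classical in
/-- The heat kernels of the closed faces. -/
def closedKernel [Fintype W] [Fintype B] [Fintype L] (G : TensorGraph W B L)
    (α h : L → ℝ) : ℝ :=
  letI := Fintype.ofFinite G.Face
  ∏ f : G.Face with G.IsClosedFace f, heatKernel (G.faceSum α f) (G.faceSum h f)

open Classical in
/-- The heat kernels of the open faces that contain at least one line. Such a face is
described by its colour, its source `b` and its target `w`. -/
def openKernel [Fintype W] [Fintype B] [Fintype L] (G : TensorGraph W B L)
    (α h : L → ℝ) (g : G.Boundary) : ℝ :=
  ∏ ℓ : Fin 4, ∏ b : G.ExtBlack, ∏ w : G.ExtWhite,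
    if (G.coloredPart {none, some ℓ}).Reachable (Sum.inr b.1) (Sum.inl w.1) ∧
        G.color ℓ w.1 ≠ b.1
      then heatKernel (G.faceSum α (G.openFace ℓ b))
        (g.1 (ℓ, b) + G.faceSum h (G.openFace ℓ b) - g.2 (ℓ, w))
      else 1

open Classical in
/-- The measure `∏ dα_e ∏ dh_e ∏ dg`, with `α_e` in the slice of scale `μ e`. -/
def scaleMeasure [Fintype W] [Fintype B] [Fintype L] (G : TensorGraph W B L)
    (M : ℝ) (μ : L → ℕ) : Measure G.Config :=
  (Measure.pi fun e => volume.restrict (slice M (μ e))).prod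
    ((Measure.pi fun _ => haarAngle).prod
      ((Measure.pi fun _ => haarAngle).prod (Measure.pi fun _ => haarAngle)))

/-- The integrand of the amplitude with mass `m`, paired with a function `u` of the boundary
variables. -/
def integrand [Fintype W] [Fintype B] [Fintype L] (G : TensorGraph W B L)
    (m : ℝ) (u : G.Boundary → ℂ) (x : G.Config) : ℂ :=
  ((∏ e, Real.exp (-m ^ 2 * x.1 e)) * G.closedKernel x.1 x.2.1 *
    G.openKernel x.1 x.2.1 x.2.2 : ℝ) * u (G.identify x.2.2)

/-- The amplitude `A_{G,μ}` at scale attribution `μ`, a distribution in the boundary variables,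
evaluated on the function `u`. -/
def amplitude [Fintype W] [Fintype B] [Fintype L] (G : TensorGraph W B L)
    (M m : ℝ) (μ : L → ℕ) (u : G.Boundary → ℂ) : ℂ :=
  ∫ x, G.integrand m u x ∂(G.scaleMeasure M μ)

end TensorGraph

end

/-!
Order the lines by decreasing distance to an external leg. Then no line is the last one on all four
of its faces, since the next node on a shortest path to the leg lies on an open face or on a later
line. Say that a line closes the faces of which it is the last line. If the lines of a subgraph
attached to some bubble all close three of its faces, then they all have both ends on this bubble
and successively form melonic dipoles, so that the bubble carries a melopole. In a graph without
melopole, each bubble met by a subgraph therefore has a line closing at most two faces, and for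
bubbles with at most `p` nodes these lines are a fraction at least `1 / (2 p)` of the subgraph.

In Fourier space, the holonomies impose that the momenta of the faces add up to zero along each
line. With `k` faces closed by a line, its constraint leaves `k - 1` of their momenta free, hence
the momenta of a subgraph with `n` lines span a space of dimension at most `(2 - 1 / (2 p)) n`.
Applied to the subgraphs of the lines of scale larger than `i`, for all `i`, this yields a set `P`
of closed faces, pivots of the space of momenta, whose scales sum to at most `(2 - 1 / (2 p))` times
the sum of the scales of the lines, while the holonomies of the other closed faces are independent.

A heat kernel of scale `i` is bounded by a constant times `M ^ i`, which is used for the faces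
of `P`. All other faces integrate to one: the closed ones by a change of variables on the torus, the
open ones by integrating their target angles. As the Schwinger parameter of a line of scale `i`
contributes `M ^ (-2 i)`, what remains is `M ^ (-i / (2 p))` per line, a convergent geometric
series.
-/

noncomputable section

section Order

theorem exists_injective_refinement {α β : Type*} [Finite α] [LinearOrder β] (k : α → β) :
    ∃ ρ : α → ℕ, ρ.Injective ∧ ∀ a b, k a < k b → ρ a < ρ b := by
  obtain ⟨n, ⟨φ⟩⟩ := Finite.exists_equiv_fin α
  let key : α → β ×ₗ Fin n := fun a => toLex (k a, φ a)
  have key_injective : key.Injective := fun a b h =>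
    φ.injective (congrArg Prod.snd (toLex.injective h))
  have rank_lt : ∀ a b, key a < key b →
      {c | key c < key a}.ncard < {c | key c < key b}.ncard := fun a b h =>
    Set.ncard_lt_ncard ⟨fun c hc => lt_trans hc h, fun hsub => lt_irrefl (key a) (hsub h)⟩
  refine ⟨fun a => {c | key c < key a}.ncard, fun a b hab => ?_, fun a b h =>
    rank_lt a b (Prod.Lex.toLex_lt_toLex.2 (Or.inl h))⟩
  by_contra hne
  rcases (key_injective.ne hne).lt_or_gt with h | h
  · exact (rank_lt a b h).ne hab
  · exact (rank_lt b a h).ne' hab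

theorem exists_list_pairwise_lt {α β : Type*} [LinearOrder β] {ρ : α → β} (hρ : ρ.Injective)
    (s : Finset α) : ∃ l : List α, l.Pairwise (fun a b => ρ a < ρ b) ∧ ∀ a, a ∈ l ↔ a ∈ s := by
  let _ := LinearOrder.lift' ρ hρ
  exact ⟨s.sort (· ≤ ·), (Finset.sortedLT_sort s).pairwise, fun a => Finset.mem_sort _⟩

theorem ncard_setOf_exists_lt_le {α : Type*} [Finite α] [LinearOrder α] (s : Set α) :
    {a ∈ s | ∃ b ∈ s, b < a}.ncard ≤ s.ncard - 1 := by
  rcases s.eq_empty_or_nonempty with rfl | hs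
  · simp
  obtain ⟨a, ha, hmin⟩ := Set.exists_min_image s id s.toFinite hs
  refine Nat.le_sub_one_of_lt (Set.ncard_lt_ncard ⟨Set.sep_subset _ _, fun hsub => ?_⟩)
  obtain ⟨-, b, hb, hlt⟩ := hsub ha
  exact hlt.not_ge (hmin b hb)

theorem sum_eq_sum_range_card_lt {α : Type*} (s : Finset α) (k : α → ℕ) {N : ℕ}
    (hN : ∀ a ∈ s, k a ≤ N) :
    ∑ a ∈ s, k a = ∑ i ∈ Finset.range N, (s.filter fun a => i < k a).card := by
  calc ∑ a ∈ s, k a = ∑ a ∈ s, ((Finset.range N).filter fun i => i < k a).card := by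
        refine Finset.sum_congr rfl fun a ha => ?_
        have : ((Finset.range N).filter fun i => i < k a) = Finset.range (k a) := by
          ext i
          have := hN a ha
          simp only [Finset.mem_filter, Finset.mem_range]
          omega
        rw [this, Finset.card_range]
    _ = ∑ i ∈ Finset.range N, (s.filter fun a => i < k a).card :=
        Finset.sum_card_bipartiteAbove_eq_sum_card_bipartiteBelow fun a i => i < k a

theorem sum_prod_le_prod_tsum {ι κ : Type*} [Fintype ι] {f : ι → κ → ℝ}
    (hf : ∀ i, Summable (f i)) (hf₀ : ∀ i j, 0 ≤ f i j) (s : Finset (ι → κ)) :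
    ∑ x ∈ s, ∏ i, f i (x i) ≤ ∏ i, ∑' j, f i j := by
  classical
  let t : ι → Finset κ := fun i => s.image fun x => x i
  have hst : s ⊆ Fintype.piFinset t := fun x hx =>
    Fintype.mem_piFinset.2 fun i => Finset.mem_image_of_mem _ hx
  calc ∑ x ∈ s, ∏ i, f i (x i) ≤ ∑ x ∈ Fintype.piFinset t, ∏ i, f i (x i) :=
        Finset.sum_le_sum_of_subset_of_nonneg hst fun x _ _ =>
          Finset.prod_nonneg fun i _ => hf₀ i (x i)
    _ = ∏ i, ∑ j ∈ t i, f i j := (Finset.prod_univ_sum t f).symm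
    _ ≤ ∏ i, ∑' j, f i j := Finset.prod_le_prod
        (fun i _ => Finset.sum_nonneg fun j _ => hf₀ i j)
        fun i _ => (hf i).sum_le_tsum _ fun j _ => hf₀ i j

theorem exists_adj_dist_lt {V : Type*} {Γ : SimpleGraph V} {x z : V} (hΓ : Γ.Reachable x z)
    (hne : x ≠ z) : ∃ y, Γ.Adj x y ∧ Γ.dist y z < Γ.dist x z := by
  obtain ⟨p, hp⟩ := hΓ.exists_walk_length_eq_dist
  cases p with
  | nil => exact absurd rfl hne
  | cons hadj q =>
    refine ⟨_, hadj, ?_⟩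
    have := SimpleGraph.dist_le q
    rw [SimpleGraph.Walk.length_cons] at hp
    omega

end Order

section Pivots

variable {K ι β : Type*} [Field K] [LinearOrder β]

theorem finrank_le_ncard_of_forall_eq_zero [Finite ι] {V : Submodule K (ι → K)} {Z : Set ι}
    (h : ∀ n ∈ V, (∀ i ∈ Z, n i = 0) → n = 0) : Module.finrank K V ≤ Z.ncard := by
  have := Fintype.ofFinite Z
  let φ : V →ₗ[K] Z → K := LinearMap.funLeft K K (Subtype.val : Z → ι) ∘ₗ V.subtype
  have hφ : Function.Injective φ := (injective_iff_map_eq_zero φ).2 fun n hn =>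
    Subtype.ext (h n n.2 fun i hi => congrFun hn ⟨i, hi⟩)
  simpa [← Nat.card_eq_fintype_card] using LinearMap.finrank_le_finrank_of_injective hφ

/-- The pivots of a space of vectors: the positions, in the order of the coordinates given by `τ`,
of the first nonzero coordinate of its elements. -/
def pivots (V : Submodule K (ι → K)) (τ : ι → β) : Set ι :=
  {i | ∃ n ∈ V, n i ≠ 0 ∧ ∀ j, τ j < τ i → n j = 0}

theorem exists_mem_pivots [Finite ι] {V : Submodule K (ι → K)} (τ : ι → β) {n : ι → K}
    (hn : n ∈ V) (hne : n ≠ 0) : ∃ i ∈ pivots V τ, n i ≠ 0 := by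
  obtain ⟨i, hi, hmin⟩ := Set.exists_min_image {i | n i ≠ 0} τ (Set.toFinite _)
    (Function.ne_iff.1 hne)
  refine ⟨i, ⟨n, hn, hi, fun j hj => ?_⟩, hi⟩
  by_contra hnj
  exact (hmin j hnj).not_gt hj

theorem ncard_le_finrank_of_subset_pivots [Finite ι] {V : Submodule K (ι → K)} {τ : ι → β}
    (hτ : τ.Injective) {Q : Set ι} (hQ : Q ⊆ pivots V τ) : Q.ncard ≤ Module.finrank K V := by
  have := Fintype.ofFinite Q
  choose! n hnV hn_ne hn_lt using fun i (hi : i ∈ Q) => hQ hi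
  have hli : LinearIndependent K fun i : Q => (⟨n i, hnV i i.2⟩ : V) := by
    rw [Fintype.linearIndependent_iff]
    intro c hc
    by_contra! hne
    obtain ⟨i, hci, hmin⟩ := Set.exists_min_image {i : Q | c i ≠ 0} (fun i => τ i)
      (Set.toFinite _) hne
    have sum_coord : ∑ j : Q, c j * n j i = 0 := by
      simpa using congrFun (congrArg Subtype.val hc) i
    rw [Finset.sum_eq_single_of_mem i (Finset.mem_univ i) fun j _ hji => ?_] at sum_coord
    · exact mul_ne_zero hci (hn_ne i i.2) sum_coord
    · by_cases hcj : c j = 0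
      · rw [hcj, zero_mul]
      · rw [hn_lt j j.2 i ((hmin j hcj).lt_of_ne (hτ.ne (Subtype.coe_ne_coe.2 hji.symm))),
          mul_zero]
  simpa [← Nat.card_eq_fintype_card] using hli.fintype_card_le_finrank

end Pivots

section HeatKernel

theorem summable_exp_neg_mul_int_sq {a : ℝ} (ha : 0 < a) :
    Summable fun n : ℤ => Real.exp (-a * (n : ℝ) ^ 2) := by
  have hT : 0 < a / Real.pi := div_pos ha Real.pi_pos
  refine (summable_pow_mul_jacobiTheta₂_term_bound 0 hT 0).congr fun n => ?_
  rw [pow_zero, one_mul]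
  congr 1
  field_simp
  push_cast
  ring

theorem tsum_exp_neg_mul_int_sq_anti {a b : ℝ} (ha : 0 < a) (hab : a ≤ b) :
    ∑' n : ℤ, Real.exp (-b * (n : ℝ) ^ 2) ≤ ∑' n : ℤ, Real.exp (-a * (n : ℝ) ^ 2) :=
  (summable_exp_neg_mul_int_sq (ha.trans_le hab)).tsum_le_tsum (fun n => by gcongr)
    (summable_exp_neg_mul_int_sq ha)

theorem heatKernel_nonneg (α θ : ℝ) : 0 ≤ heatKernel α θ :=
  mul_nonneg (Real.sqrt_nonneg _) (tsum_nonneg fun _ => (Real.exp_pos _).le)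

theorem measurable_heatKernel : Measurable fun x : ℝ × ℝ => heatKernel x.1 x.2 := by
  unfold heatKernel
  refine Measurable.mul (by fun_prop) ?_
  exact Measurable.tsum fun n => by fun_prop

theorem heatKernel_periodic (α : ℝ) : Function.Periodic (heatKernel α) (2 * Real.pi) := by
  intro θ
  rw [heatKernel, heatKernel, ← (Equiv.addRight (1 : ℤ)).tsum_eq]
  simp only [Equiv.coe_addRight, Int.cast_add, Int.cast_one]
  ring_nf

/-- Poisson summation turns the sum over images into the spectral expansion. -/
theorem heatKernel_eq_tsum_cexp {α : ℝ} (hα : 0 < α) (θ : ℝ) :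
    (heatKernel α θ : ℂ) =
      ∑' n : ℤ, Complex.exp ((-α * (n : ℝ) ^ 2 : ℝ) + (n * θ : ℝ) * Complex.I) := by
  have hpi := Real.pi_pos
  have hpi' : (Real.pi : ℂ) ≠ 0 := by exact_mod_cast hpi.ne'
  have hα' : (α : ℂ) ≠ 0 := by exact_mod_cast hα.ne'
  have poisson := Complex.tsum_exp_neg_quadratic (a := (α / Real.pi : ℝ))
    (by rw [Complex.ofReal_re]; positivity) (Complex.I * θ / (2 * Real.pi))
  rw [show (1 / 2 : ℂ) = ((1 / 2 : ℝ) : ℂ) by norm_num, ← Complex.ofReal_cpow (by positivity),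
    ← Real.sqrt_eq_rpow, one_div, ← Complex.ofReal_inv, ← mul_div_assoc Complex.I,
    ← mul_assoc Complex.I, Complex.I_mul_I] at poisson
  rw [heatKernel, Complex.ofReal_mul, Complex.ofReal_tsum, ← inv_div, Real.sqrt_inv]
  refine Eq.trans ?_ (poisson.symm.trans (tsum_congr fun n => ?_))
  · congr! 4 with n
    rw [Complex.ofReal_exp]
    congr 1
    push_cast
    field_simp
    ring
  · push_cast
    field_simp

theorem heatKernel_eq_tsum_cos {α : ℝ} (hα : 0 < α) (θ : ℝ) :
    heatKernel α θ = ∑' n : ℤ, Real.exp (-α * (n : ℝ) ^ 2) * Real.cos (n * θ) := by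
  let z : ℤ → ℂ := fun n => ((-α * (n : ℝ) ^ 2 : ℝ) : ℂ) + ((n * θ : ℝ) : ℂ) * Complex.I
  have z_re : ∀ n, (z n).re = -α * (n : ℝ) ^ 2 := fun n => by
    simp only [z, Complex.add_re, Complex.ofReal_re, Complex.re_ofReal_mul, Complex.I_re,
      mul_zero, add_zero]
  have z_im : ∀ n, (z n).im = n * θ := fun n => by
    simp only [z, Complex.add_im, Complex.ofReal_im, Complex.im_ofReal_mul, Complex.I_im,
      mul_one, zero_add]
  have hz : Summable fun n => Complex.exp (z n) :=
    Summable.of_norm ((summable_exp_neg_mul_int_sq hα).congr fun n => by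
      rw [Complex.norm_exp, z_re])
  rw [← Complex.ofReal_re (heatKernel α θ), heatKernel_eq_tsum_cexp hα, Complex.re_tsum hz]
  exact tsum_congr fun n => by rw [Complex.exp_re, z_re, z_im]

theorem norm_exp_mul_cos_le (x y : ℝ) : ‖Real.exp x * Real.cos y‖ ≤ Real.exp x := by
  rw [norm_mul, Real.norm_of_nonneg (Real.exp_pos x).le]
  exact mul_le_of_le_one_right (Real.exp_pos x).le (Real.abs_cos_le_one y)

theorem heatKernel_le_heatKernel_zero {α : ℝ} (hα : 0 < α) (θ : ℝ) :
    heatKernel α θ ≤ heatKernel α 0 := by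
  rw [heatKernel_eq_tsum_cos hα, heatKernel_eq_tsum_cos hα]
  simp only [mul_zero, Real.cos_zero, mul_one]
  have hs := summable_exp_neg_mul_int_sq hα
  exact (Summable.of_norm_bounded hs fun n => norm_exp_mul_cos_le _ _).tsum_le_tsum
    (fun n => (le_abs_self _).trans (norm_exp_mul_cos_le _ _)) hs

/-- The constant `C` of the bound `heatKernel α θ ≤ C / √α` for small `α`. -/
def heatKernelConst : ℝ :=
  2 * ∑' n : ℤ, Real.exp (-1 * (n : ℝ) ^ 2)

theorem two_le_heatKernelConst : 2 ≤ heatKernelConst := by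
  have h := (summable_exp_neg_mul_int_sq one_pos).le_tsum 0 fun _ _ => (Real.exp_pos _).le
  simp only [Int.cast_zero, ne_eq, OfNat.ofNat_ne_zero, not_false_eq_true, zero_pow, mul_zero,
    Real.exp_zero] at h
  rw [heatKernelConst]
  linarith

theorem heatKernel_le {α R : ℝ} (hα : 0 < α) (hR : 1 ≤ R) (hαR : 1 ≤ α * R ^ 2) (θ : ℝ) :
    heatKernel α θ ≤ heatKernelConst * R := by
  have hpi := Real.pi_pos
  have hC := two_le_heatKernelConst
  refine (heatKernel_le_heatKernel_zero hα θ).trans ?_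
  rcases le_total 1 α with h | h
  · calc heatKernel α 0 = ∑' n : ℤ, Real.exp (-α * (n : ℝ) ^ 2) := by
          simp [heatKernel_eq_tsum_cos hα]
      _ ≤ heatKernelConst / 2 := by
          rw [heatKernelConst, mul_div_cancel_left₀ _ two_ne_zero]
          exact tsum_exp_neg_mul_int_sq_anti one_pos h
      _ ≤ heatKernelConst * R := by nlinarith
  · have sqrt_le : √(Real.pi / α) ≤ 2 * R := by
      rw [Real.sqrt_le_left (by positivity), div_le_iff₀ hα]
      nlinarith [Real.pi_le_four]
    have one_le : 1 ≤ Real.pi ^ 2 / α := by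
      rw [le_div_iff₀ hα]
      nlinarith [Real.pi_gt_three]
    calc heatKernel α 0 =
          √(Real.pi / α) * ∑' n : ℤ, Real.exp (-(Real.pi ^ 2 / α) * (n : ℝ) ^ 2) := by
          rw [heatKernel]
          congr! 4 with n
          ring
      _ ≤ 2 * R * (heatKernelConst / 2) := by
          rw [heatKernelConst, mul_div_cancel_left₀ _ two_ne_zero]
          have := tsum_exp_neg_mul_int_sq_anti one_pos one_le
          gcongr
      _ = heatKernelConst * R := by ring

end HeatKernel

section Circle

instance fact_two_pi_pos : Fact (0 < 2 * Real.pi) := ⟨Real.two_pi_pos⟩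

theorem measurePreserving_haarAngle :
    MeasurePreserving ((↑) : ℝ → AddCircle (2 * Real.pi)) haarAngle AddCircle.haarAddCircle := by
  have h := AddCircle.measurePreserving_mk (2 * Real.pi) 0
  have hne : ENNReal.ofReal (2 * Real.pi) ≠ 0 := by simp [Real.pi_pos]
  refine ⟨h.measurable, ?_⟩
  rw [zero_add] at h
  rw [haarAngle, Measure.map_smul, restrict_Ico_eq_restrict_Ioc, h.map_eq,
    AddCircle.volume_eq_smul_haarAddCircle, smul_smul,
    ENNReal.inv_mul_cancel hne ENNReal.ofReal_ne_top, one_smul]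

instance isProbabilityMeasure_haarAngle : IsProbabilityMeasure haarAngle := by
  have h := measurePreserving_haarAngle.measure_preimage MeasurableSet.univ.nullMeasurableSet
  exact ⟨by simpa using h⟩

theorem integral_cos_int_mul_haarAngle (n : ℤ) :
    ∫ θ, Real.cos (n * θ) ∂haarAngle = if n = 0 then 1 else 0 := by
  split_ifs with hn
  · simp [hn]
  · have hn' : (n : ℝ) ≠ 0 := by exact_mod_cast hn
    rw [haarAngle, integral_smul_measure, integral_Ico_eq_integral_Ioc,
      ← intervalIntegral.integral_of_le Real.two_pi_pos.le,
      intervalIntegral.integral_comp_mul_left (f := Real.cos) hn', integral_cos, mul_zero,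
      Real.sin_periodic.int_mul_eq, sub_self, smul_zero, smul_zero]

theorem integrable_heatKernel {α : ℝ} (hα : 0 < α) : Integrable (heatKernel α) haarAngle := by
  refine .of_bound (measurable_heatKernel.comp measurable_prodMk_left).aestronglyMeasurable
    (heatKernel α 0) (.of_forall fun θ => ?_)
  rw [Real.norm_of_nonneg (heatKernel_nonneg α θ)]
  exact heatKernel_le_heatKernel_zero hα θ

theorem integral_heatKernel {α : ℝ} (hα : 0 < α) : ∫ θ, heatKernel α θ ∂haarAngle = 1 := by
  let F : ℤ → ℝ → ℝ := fun n θ => Real.exp (-α * (n : ℝ) ^ 2) * Real.cos (n * θ)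
  have norm_le : ∀ n θ, ‖F n θ‖ ≤ Real.exp (-α * (n : ℝ) ^ 2) := fun _ _ =>
    norm_exp_mul_cos_le _ _
  have hF : ∀ n, Integrable (F n) haarAngle := fun n =>
    .of_bound (by fun_prop) _ (.of_forall (norm_le n))
  have hF_sum : Summable fun n => ∫ θ, ‖F n θ‖ ∂haarAngle :=
    .of_nonneg_of_le (fun n => integral_nonneg fun θ => norm_nonneg _) (fun n => by
      simpa using integral_mono (hF n).norm (integrable_const _) (norm_le n))
      (summable_exp_neg_mul_int_sq hα)
  calc ∫ θ, heatKernel α θ ∂haarAngle = ∑' n, ∫ θ, F n θ ∂haarAngle := by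
        rw [integral_tsum_of_summable_integral_norm hF hF_sum]
        simp_rw [heatKernel_eq_tsum_cos hα, F]
    _ = 1 := by
        simp_rw [F, integral_const_mul, integral_cos_int_mul_haarAngle]
        simp

theorem lintegral_heatKernel_le (α : ℝ) :
    ∫⁻ θ, ENNReal.ofReal (heatKernel α θ) ∂haarAngle ≤ 1 := by
  rcases le_or_gt α 0 with hα | hα
  · have : √(Real.pi / α) = 0 :=
      Real.sqrt_eq_zero_of_nonpos (div_nonpos_of_nonneg_of_nonpos Real.pi_pos.le hα)
    simp [heatKernel, this]
  · rw [← ofReal_integral_eq_lintegral_ofReal (integrable_heatKernel hα)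
      (.of_forall (heatKernel_nonneg α)), integral_heatKernel hα, ENNReal.ofReal_one]

/-- The heat kernel as a function on the circle. Extended nonnegative values make it integrable in
the sense of `lintegral` without side conditions. -/
def circleKernel (α : ℝ) (x : AddCircle (2 * Real.pi)) : ENNReal :=
  ENNReal.ofReal ((heatKernel_periodic α).lift x)

theorem circleKernel_coe (α θ : ℝ) : circleKernel α θ = ENNReal.ofReal (heatKernel α θ) := by
  rw [circleKernel, Function.Periodic.lift_coe]

theorem measurable_circleKernel (α : ℝ) : Measurable (circleKernel α) :=
  QuotientAddGroup.measurable_from_quotient.2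
    (measurable_heatKernel.comp measurable_prodMk_left).ennreal_ofReal

theorem lintegral_circleKernel_le (α : ℝ) :
    ∫⁻ x, circleKernel α x ∂AddCircle.haarAddCircle ≤ 1 := by
  rw [← measurePreserving_haarAngle.lintegral_comp (measurable_circleKernel α)]
  simp_rw [circleKernel_coe]
  exact lintegral_heatKernel_le α

theorem lintegral_heatKernel_sub_le (α c : ℝ) :
    ∫⁻ θ, ENNReal.ofReal (heatKernel α (c - θ)) ∂haarAngle ≤ 1 := by
  simp_rw [← circleKernel_coe, AddCircle.coe_sub]
  rw [measurePreserving_haarAngle.lintegral_comp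
    (f := fun x => circleKernel α ((c : AddCircle (2 * Real.pi)) - x))
    ((measurable_circleKernel α).comp (measurable_id.const_sub _)),
    lintegral_sub_left_eq_self (circleKernel α)]
  exact lintegral_circleKernel_le α

end Circle

section IndependentAngles

theorem lintegral_pi_prod {ι : Type*} [Fintype ι] {Ω : ι → Type*} [∀ i, MeasurableSpace (Ω i)]
    (ν : ∀ i, Measure (Ω i)) [∀ i, IsProbabilityMeasure (ν i)] {F : ∀ i, Ω i → ENNReal}
    (hF : ∀ i, Measurable (F i)) :
    ∫⁻ x, ∏ i, F i (x i) ∂Measure.pi ν = ∏ i, ∫⁻ y, F i y ∂ν i := by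
  rw [ProbabilityTheory.lintegral_prod_eq_prod_lintegral_of_indepFun (μ := Measure.pi ν)
    Finset.univ (fun i x => F i (x i))
    (ProbabilityTheory.iIndepFun_pi fun i => (hF i).aemeasurable)
    fun i => (hF i).comp (measurable_pi_apply i)]
  exact Finset.prod_congr rfl fun i _ => (measurePreserving_eval ν i).lintegral_comp (hF i)

variable {Q Λ : Type*} [Fintype Λ]

theorem mulVec_surjective_of_linearIndependent_row [Finite Q] {K : Type*} [Field K]
    {A : Matrix Q Λ K} (hA : LinearIndependent K A.row) : Function.Surjective A.mulVec := by
  have := Fintype.ofFinite Q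
  have hrange : A.mulVecLin.range = ⊤ := by
    refine Submodule.eq_top_of_finrank_eq ?_
    rw [Module.finrank_fintype_fun_eq_card]
    exact hA.rank_matrix
  exact LinearMap.range_eq_top.1 hrange

theorem coe_sum_intCast_mul {T : ℝ} (a : Λ → ℤ) (x : Λ → ℝ) :
    ((∑ j, a j * x j : ℝ) : AddCircle T) = ∑ j, a j • (x j : AddCircle T) := by
  simp_rw [← zsmul_eq_mul]
  exact (map_sum (QuotientAddGroup.mk' (AddSubgroup.zmultiples T)) _ _).trans
    (Finset.sum_congr rfl fun j _ => AddCircle.coe_zsmul T)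

variable [Fintype Q]

theorem measurePreserving_sum_zsmul {T : ℝ} [Fact (0 < T)] {A : Q → Λ → ℤ}
    (hA : LinearIndependent ℝ fun i j => (A i j : ℝ)) :
    MeasurePreserving (fun (x : Λ → AddCircle T) i => ∑ j, A i j • x j)
      (Measure.pi fun _ => AddCircle.haarAddCircle)
      (Measure.pi fun _ => AddCircle.haarAddCircle) := by
  let Φ : (Λ → AddCircle T) →+ (Q → AddCircle T) :=
    { toFun := fun x i => ∑ j, A i j • x j
      map_add' := fun x y => by ext; simp [Finset.sum_add_distrib]
      map_zero' := by ext; simp }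
  have hcont : Continuous Φ := continuous_pi fun i =>
    continuous_finsetSum _ fun j _ => (continuous_apply j).zsmul (A i j)
  -- A target lifts to `Q → ℝ`, where the equations form a linear system of full row rank.
  have hsurj : Function.Surjective Φ := by
    intro y
    choose t ht using fun i => QuotientAddGroup.mk_surjective (y i)
    obtain ⟨x, hx⟩ := mulVec_surjective_of_linearIndependent_row
      (A := Matrix.of fun i j => (A i j : ℝ)) hA t
    refine ⟨fun j => (x j : AddCircle T), funext fun i => ?_⟩
    rw [← ht i, ← hx]
    exact (coe_sum_intCast_mul (A i) x).symm
  exact AddMonoidHom.measurePreserving hcont hsurj (by simp)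

theorem lintegral_prod_sum_mul_haarAngle {A : Q → Λ → ℤ}
    (hA : LinearIndependent ℝ fun i j => (A i j : ℝ))
    {F : Q → AddCircle (2 * Real.pi) → ENNReal} (hF : ∀ i, Measurable (F i)) :
    ∫⁻ x, ∏ i, F i ((∑ j, A i j * x j : ℝ) : AddCircle (2 * Real.pi))
      ∂Measure.pi (fun _ : Λ => haarAngle) = ∏ i, ∫⁻ y, F i y ∂AddCircle.haarAddCircle := by
  have hmap := (measurePreserving_sum_zsmul hA).comp
    (measurePreserving_pi (fun _ : Λ => haarAngle) _ fun _ => measurePreserving_haarAngle)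
  rw [← lintegral_pi_prod _ hF, ← hmap.lintegral_comp (f := fun y => ∏ i, F i (y i))
    (Finset.measurable_prod _ fun i _ => (hF i).comp (measurable_pi_apply i))]
  exact lintegral_congr fun x => Finset.prod_congr rfl fun i _ => by
    rw [coe_sum_intCast_mul, Function.comp_apply]

end IndependentAngles

section Slices

variable {M m : ℝ}

theorem measurableSet_slice (M : ℝ) (i : ℕ) : MeasurableSet (slice M i) := by
  cases i with
  | zero => exact measurableSet_Ici
  | succ i => exact measurableSet_Icc

theorem one_le_mul_sq_of_mem_slice (hM : 0 < M) {i : ℕ} {α : ℝ} (hα : α ∈ slice M i) :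
    1 ≤ α * (M ^ i) ^ 2 := by
  cases i with
  | zero => simpa using Set.mem_Ici.1 hα
  | succ i =>
    rw [← pow_mul, mul_comm (i + 1)]
    exact (inv_le_iff_one_le_mul₀ (by positivity)).1 hα.1

theorem pos_of_mem_slice (hM : 0 < M) {i : ℕ} {α : ℝ} (hα : α ∈ slice M i) : 0 < α :=
  pos_of_mul_pos_left (one_pos.trans_le (one_le_mul_sq_of_mem_slice hM hα)) (sq_nonneg _)

theorem integrableOn_exp_slice (hm : m ≠ 0) (M : ℝ) (i : ℕ) :
    IntegrableOn (fun α => Real.exp (-m ^ 2 * α)) (slice M i) := by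
  cases i with
  | zero =>
    rw [slice, integrableOn_Ici_iff_integrableOn_Ioi]
    exact integrableOn_exp_mul_Ioi (neg_lt_zero.2 (by positivity)) 1
  | succ i => exact Continuous.integrableOn_Icc (by fun_prop)

theorem integral_exp_slice_zero_le (hm : m ≠ 0) (M : ℝ) :
    ∫ α in slice M 0, Real.exp (-m ^ 2 * α) ≤ (m ^ 2)⁻¹ := by
  rw [slice, integral_Ici_eq_integral_Ioi, integral_exp_mul_Ioi (neg_lt_zero.2 (by positivity)),
    neg_div_neg_eq, div_eq_mul_inv]
  exact mul_le_of_le_one_left (by positivity) (Real.exp_le_one_iff.2 (by nlinarith [sq_nonneg m]))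

theorem integral_exp_slice_succ_le (hM : 1 ≤ M) (m : ℝ) (i : ℕ) :
    ∫ α in slice M (i + 1), Real.exp (-m ^ 2 * α) ≤ (M ^ (2 * i))⁻¹ := by
  have hM₀ : 0 < M := one_pos.trans_le hM
  have hle : (M ^ (2 * (i + 1)))⁻¹ ≤ (M ^ (2 * i))⁻¹ := by
    gcongr
    exact i.le_succ
  have hexp : ∀ α ∈ slice M (i + 1), Real.exp (-m ^ 2 * α) ≤ 1 := fun α hα =>
    Real.exp_le_one_iff.2 (by nlinarith [pos_of_mem_slice hM₀ hα, sq_nonneg m])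
  calc ∫ α in slice M (i + 1), Real.exp (-m ^ 2 * α)
    _ ≤ ∫ _ in slice M (i + 1), (1 : ℝ) :=
        setIntegral_mono_on (Continuous.integrableOn_Icc (by fun_prop))
          (integrableOn_const (by simp [slice])) (measurableSet_slice M _) hexp
    _ = (M ^ (2 * i))⁻¹ - (M ^ (2 * (i + 1)))⁻¹ := by
        rw [slice, setIntegral_const, smul_eq_mul, mul_one, Real.volume_real_Icc_of_le hle]
    _ ≤ (M ^ (2 * i))⁻¹ := sub_le_self _ (by positivity)

theorem integral_exp_slice_le (hM : 1 ≤ M) (hm : m ≠ 0) (i : ℕ) :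
    ∫ α in slice M i, Real.exp (-m ^ 2 * α) ≤ ((m ^ 2)⁻¹ + M ^ 2) * ((M ^ i) ^ 2)⁻¹ := by
  rw [add_mul]
  cases i with
  | zero => simpa using (integral_exp_slice_zero_le hm M).trans (by nlinarith [sq_nonneg M])
  | succ i =>
    have : 0 < M := one_pos.trans_le hM
    have hpow : M ^ 2 * ((M ^ (i + 1)) ^ 2)⁻¹ = (M ^ (2 * i))⁻¹ := by
      field_simp
      ring
    rw [hpow]
    exact (integral_exp_slice_succ_le hM m i).trans (le_add_of_nonneg_left (by positivity))

end Slices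

namespace TensorGraph

variable {W B L : Type} {G : TensorGraph W B L} {e : L}

section Faces

variable {C : Set (Option (Fin 4))} {k : Option (Fin 4)} {w : W} {b : B} {x y : W ⊕ B}
  {f : G.Face}

/-- The face of colour `ℓ` through the line `e`. -/
def faceAt (G : TensorGraph W B L) (ℓ : Fin 4) (e : L) : G.Face :=
  ⟨ℓ, (G.coloredPart {none, some ℓ}).connectedComponentMk (Sum.inl (G.whiteEnd e))⟩

/-- The node `x` is one of the two ends of the line `e`. -/
def IsEnd (G : TensorGraph W B L) (e : L) (x : W ⊕ B) : Prop :=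
  x = Sum.inl (G.whiteEnd e) ∨ x = Sum.inr (G.blackEnd e)

theorem coloredPart_adj : (G.coloredPart C).Adj x y ↔ ∃ k ∈ C, ∃ w b, G.Joined k w b ∧
    (x = Sum.inl w ∧ y = Sum.inr b ∨ x = Sum.inr b ∧ y = Sum.inl w) := by
  rw [coloredPart, SimpleGraph.fromRel_adj]
  constructor
  · rintro ⟨-, ⟨k, hk, w, b, rfl, rfl, h⟩ | ⟨k, hk, w, b, rfl, rfl, h⟩⟩
    · exact ⟨k, hk, w, b, h, .inl ⟨rfl, rfl⟩⟩
    · exact ⟨k, hk, w, b, h, .inr ⟨rfl, rfl⟩⟩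
  · rintro ⟨k, hk, w, b, h, ⟨rfl, rfl⟩ | ⟨rfl, rfl⟩⟩
    · exact ⟨by simp, .inl ⟨k, hk, w, b, rfl, rfl, h⟩⟩
    · exact ⟨by simp, .inr ⟨k, hk, w, b, rfl, rfl, h⟩⟩

theorem joined_color (ℓ : Fin 4) (w : W) : G.Joined (some ℓ) w (G.color ℓ w) := rfl

theorem joined_ends (e : L) : G.Joined none (G.whiteEnd e) (G.blackEnd e) := ⟨e, rfl, rfl⟩

theorem Joined.reachable (h : G.Joined k w b) (hk : k ∈ C) :
    (G.coloredPart C).Reachable (Sum.inl w) (Sum.inr b) :=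
  (coloredPart_adj.2 ⟨k, hk, w, b, h, .inl ⟨rfl, rfl⟩⟩).reachable

theorem Joined.mem_supp_iff (h : G.Joined k w b) (hk : k ∈ C)
    (c : (G.coloredPart C).ConnectedComponent) : Sum.inl w ∈ c.supp ↔ Sum.inr b ∈ c.supp := by
  simp only [SimpleGraph.ConnectedComponent.mem_supp_iff,
    SimpleGraph.ConnectedComponent.sound (h.reachable hk)]

theorem rel_of_mem_supp (r : Setoid (W ⊕ B)) {c : (G.coloredPart C).ConnectedComponent}
    (hr : ∀ k ∈ C, ∀ w b, G.Joined k w b → Sum.inl w ∈ c.supp → r (Sum.inl w) (Sum.inr b))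
    (hx : x ∈ c.supp) (hy : y ∈ c.supp) : r x y := by
  obtain ⟨p⟩ := SimpleGraph.ConnectedComponent.exact (hx.trans hy.symm)
  induction p with
  | nil => exact r.refl _
  | cons hadj _ ih =>
    obtain ⟨k, hk, w, b, hj, ⟨rfl, rfl⟩ | ⟨rfl, rfl⟩⟩ := coloredPart_adj.1 hadj
    · exact r.trans (hr k hk w b hj hx) (ih ((hj.mem_supp_iff hk c).1 hx) hy)
    · have hw := (hj.mem_supp_iff hk c).2 hx
      exact r.trans (r.symm (hr k hk w b hj hw)) (ih hw hy)

theorem rel_of_reachable (r : Setoid (W ⊕ B))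
    (hr : ∀ k ∈ C, ∀ w b, G.Joined k w b → r (Sum.inl w) (Sum.inr b))
    (h : (G.coloredPart C).Reachable x y) : r x y :=
  rel_of_mem_supp r (c := (G.coloredPart C).connectedComponentMk y)
    (fun k hk w b hj _ => hr k hk w b hj) (SimpleGraph.ConnectedComponent.sound h) rfl

theorem rel_of_mem_face (r : Setoid (W ⊕ B))
    (hc : ∀ w, r (Sum.inl w) (Sum.inr (G.color f.1 w)))
    (hl : ∀ e, G.OnFace e f → r (Sum.inl (G.whiteEnd e)) (Sum.inr (G.blackEnd e)))
    (hx : x ∈ f.2.supp) (hy : y ∈ f.2.supp) : r x y := by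
  refine rel_of_mem_supp r (fun k hk w b hj hw => ?_) hx hy
  obtain rfl | rfl := hk
  · obtain ⟨e, rfl, rfl⟩ := hj
    exact hl e hw
  · obtain rfl : G.color f.1 w = b := hj
    exact hc w

theorem onFace_iff_faceAt_eq : G.OnFace e f ↔ G.faceAt f.1 e = f := by
  obtain ⟨ℓ, c⟩ := f
  simp [OnFace, faceAt, SimpleGraph.ConnectedComponent.mem_supp_iff]

theorem onFace_faceAt (ℓ : Fin 4) (e : L) : G.OnFace e (G.faceAt ℓ e) :=
  onFace_iff_faceAt_eq.2 rfl

theorem IsEnd.mem_supp_iff_onFace (hx : G.IsEnd e x) : x ∈ f.2.supp ↔ G.OnFace e f := by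
  obtain rfl | rfl := hx
  · rfl
  · exact ((joined_ends e).mem_supp_iff (.inl rfl) f.2).symm

theorem exists_mem_faceAt_of_adj (hx : G.IsEnd e x) (hxy : (G.coloredPart Set.univ).Adj x y) :
    ∃ ℓ, y ∈ (G.faceAt ℓ e).2.supp := by
  obtain ⟨k, -, w, b, hj, hends⟩ := coloredPart_adj.1 hxy
  obtain ⟨ℓ, hk⟩ : ∃ ℓ, k ∈ ({none, some ℓ} : Set (Option (Fin 4))) := by
    cases k with
    | none => exact ⟨0, .inl rfl⟩
    | some ℓ => exact ⟨ℓ, .inr rfl⟩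
  have hmem := hx.mem_supp_iff_onFace.2 (onFace_faceAt ℓ e)
  have hiff := hj.mem_supp_iff hk (G.faceAt ℓ e).2
  obtain ⟨rfl, rfl⟩ | ⟨rfl, rfl⟩ := hends
  exacts [⟨ℓ, hiff.1 hmem⟩, ⟨ℓ, hiff.2 hmem⟩]

theorem IsClosedFace.exists_isEnd (hf : G.IsClosedFace f) (hx : x ∈ f.2.supp) :
    ∃ e, G.IsEnd e x ∧ G.OnFace e f := by
  suffices ∃ e, G.IsEnd e x from this.imp fun e he => ⟨he, he.mem_supp_iff_onFace.1 hx⟩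
  obtain w | b := x
  · by_contra! h
    exact hf.1 ⟨w, fun ⟨e, he⟩ => h e (.inl (congrArg Sum.inl he.symm))⟩ hx
  · by_contra! h
    exact hf.2 ⟨b, fun ⟨e, he⟩ => h e (.inr (congrArg Sum.inr he.symm))⟩ hx

theorem IsClosedFace.exists_onFace (hf : G.IsClosedFace f) : ∃ e, G.OnFace e f :=
  let ⟨_, hx⟩ := f.2.nonempty_supp
  (hf.exists_isEnd hx).imp fun _ => And.right

end Faces

section Contraction

variable {c : Fin 4 → W ≃ B} {A : Set L} {ℓ : Fin 4}

/-- The coloured lines `c` result from `G` by contracting the lines of `A`, in any order: each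
line of `A` is an isolated pair, and the lines of `c` only join nodes that are connected, in `G`,
by lines of their colour and lines of `A`. -/
structure IsContraction (G : TensorGraph W B L) (c : Fin 4 → W ≃ B) (A : Set L) : Prop where
  isolated : ∀ ℓ, ∀ e ∈ A, c ℓ (G.whiteEnd e) = G.blackEnd e
  rel : ∀ ℓ, ∀ r : Setoid (W ⊕ B), (∀ w, r (Sum.inl w) (Sum.inr (G.color ℓ w))) →
    (∀ e ∈ A, r (Sum.inl (G.whiteEnd e)) (Sum.inr (G.blackEnd e))) →
    ∀ w, r (Sum.inl w) (Sum.inr (c ℓ w))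

theorem isContraction_empty (G : TensorGraph W B L) : G.IsContraction G.color ∅ :=
  ⟨by simp, fun _ _ h _ => h⟩

theorem IsContraction.eq_of_eq_blackEnd (h : G.IsContraction c A) {e' : L} (he' : e' ∈ A)
    (heq : c ℓ (G.whiteEnd e) = G.blackEnd e') : e = e' := by
  rw [← h.isolated ℓ e' he'] at heq
  exact G.whiteEnd.injective ((c ℓ).injective heq)

theorem IsContraction.contractLine_insert (h : G.IsContraction c A) (he : e ∉ A) :
    G.IsContraction (contractLine c (G.whiteEnd e) (G.blackEnd e)) (insert e A) := by
  classical
  refine ⟨fun ℓ e' he' => ?_, fun ℓ r hc hl w => ?_⟩ <;>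
    simp only [contractLine, Equiv.trans_apply]
  · obtain rfl | he' := he'
    · exact Equiv.swap_apply_right _ _
    · have hne : e ≠ e' := fun heq => he (heq ▸ he')
      rw [h.isolated ℓ e' he', Equiv.swap_apply_of_ne_of_ne]
      · exact fun heq => hne (G.blackEnd.injective heq).symm
      · exact fun heq => hne (h.eq_of_eq_blackEnd he' heq.symm)
  · have hA := h.rel ℓ r hc fun e' he' => hl e' (.inr he')
    have he_rel := hl e (.inl rfl)
    by_cases hb : c ℓ w = G.blackEnd e
    · rw [hb, Equiv.swap_apply_left]
      exact r.trans (hb ▸ hA w) (r.trans (r.symm he_rel) (hA _))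
    · by_cases hw : w = G.whiteEnd e
      · rwa [hw, Equiv.swap_apply_right]
      · rw [Equiv.swap_apply_of_ne_of_ne hb fun heq => hw ((c ℓ).injective heq)]
        exact hA w

theorem exists_isContraction [Finite L] (G : TensorGraph W B L) (A : Set L) :
    ∃ c, G.IsContraction c A := by
  induction A, A.toFinite using Set.Finite.induction_on with
  | empty => exact ⟨_, G.isContraction_empty⟩
  | insert he _ ih =>
    obtain ⟨c, hc⟩ := ih
    exact ⟨_, hc.contractLine_insert he⟩

theorem IsContraction.color_eq_blackEnd (h : G.IsContraction c A)
    (hcl : G.IsClosedFace (G.faceAt ℓ e))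
    (hA : ∀ e', G.OnFace e' (G.faceAt ℓ e) → e' = e ∨ e' ∈ A) :
    c ℓ (G.whiteEnd e) = G.blackEnd e := by
  have hreach := h.rel ℓ (G.coloredPart {none, some ℓ}).reachableSetoid
    (fun w => (joined_color ℓ w).reachable (by simp))
    (fun e _ => (joined_ends e).reachable (by simp)) (G.whiteEnd e)
  obtain ⟨e', hend | hend, hon⟩ := hcl.exists_isEnd
    (SimpleGraph.ConnectedComponent.sound hreach).symm
  · cases hend
  · have heq := Sum.inr_injective hend
    obtain rfl | he' := hA e' hon
    · exact heq
    · rw [h.eq_of_eq_blackEnd he' heq]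
      exact h.isolated ℓ e' he'

theorem rel_ends_of_isClosedFace [Finite L] (r : Setoid (W ⊕ B))
    (hc : ∀ w, r (Sum.inl w) (Sum.inr (G.color ℓ w))) (hcl : G.IsClosedFace (G.faceAt ℓ e))
    (hl : ∀ e', G.OnFace e' (G.faceAt ℓ e) → e' ≠ e →
      r (Sum.inl (G.whiteEnd e')) (Sum.inr (G.blackEnd e'))) :
    r (Sum.inl (G.whiteEnd e)) (Sum.inr (G.blackEnd e)) := by
  obtain ⟨c, hcA⟩ := G.exists_isContraction {e' | G.OnFace e' (G.faceAt ℓ e) ∧ e' ≠ e}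
  rw [← hcA.color_eq_blackEnd hcl fun e' he' => or_iff_not_imp_left.2 fun hne => ⟨he', hne⟩]
  exact hcA.rel ℓ r hc (fun e' he' => hl e' he'.1 he'.2) _

end Contraction

section ClosingNumber

variable {ρ : L → ℕ} {H : Set L}

/-- With the lines ordered by `ρ`, the face of colour `ℓ` through `e` is internal to `H` and `e`
is its last line. -/
def Closes (G : TensorGraph W B L) (ρ : L → ℕ) (H : Set L) (e : L) (ℓ : Fin 4) : Prop :=
  G.IsInternalFace H (G.faceAt ℓ e) ∧ ∀ e', G.OnFace e' (G.faceAt ℓ e) → ρ e' ≤ ρ e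

/-- The number of internal faces of `H` of which `e` is the last line. -/
def closingNumber (G : TensorGraph W B L) (ρ : L → ℕ) (H : Set L) (e : L) : ℕ :=
  {ℓ | G.Closes ρ H e ℓ}.ncard

/-- An order of the lines in which no line is the last one on all four of its faces. -/
structure IsGoodOrder (G : TensorGraph W B L) (ρ : L → ℕ) : Prop where
  injective : ρ.Injective
  exists_not_closes : ∀ e, ∃ ℓ, ¬ G.Closes ρ Set.univ e ℓ

theorem IsGoodOrder.closingNumber_le (hρ : G.IsGoodOrder ρ) (H : Set L) (e : L) :
    G.closingNumber ρ H e ≤ 3 := by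
  obtain ⟨ℓ, hℓ⟩ := hρ.exists_not_closes e
  have hsub : {ℓ | G.Closes ρ H e ℓ} ⊆ {ℓ}ᶜ := by
    rintro ℓ' hcl rfl
    exact hℓ ⟨⟨hcl.1.1, fun _ _ => trivial⟩, hcl.2⟩
  calc G.closingNumber ρ H e ≤ ({ℓ}ᶜ : Set (Fin 4)).ncard := Set.ncard_le_ncard hsub
    _ = 3 := by rw [Set.ncard_compl, Set.ncard_singleton, Nat.card_fin]

theorem exists_forall_not_isEnd (hG : ¬ G.IsVacuum) : ∃ x, ∀ e, ¬ G.IsEnd e x := by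
  rw [IsVacuum, not_and_or, not_isEmpty_iff, not_isEmpty_iff] at hG
  obtain ⟨⟨w, hw⟩⟩ | ⟨⟨b, hb⟩⟩ := hG
  · exact ⟨Sum.inl w, fun e he => hw ⟨e, by simpa [IsEnd, eq_comm] using he⟩⟩
  · exact ⟨Sum.inr b, fun e he => hb ⟨e, by simpa [IsEnd, eq_comm] using he⟩⟩

/-- Order the lines by decreasing distance to an external leg: the node that follows an end of
`e` on a shortest path to the leg lies on one of the faces of `e`, and belongs to a later line
if that face is closed. -/
theorem exists_isGoodOrder [Finite L] (hconn : G.IsConnected) (hG : ¬ G.IsVacuum) :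
    ∃ ρ, G.IsGoodOrder ρ := by
  obtain ⟨z, hz⟩ := exists_forall_not_isEnd hG
  let d : W ⊕ B → ℕ := fun x => (G.coloredPart Set.univ).dist x z
  let δ : L → ℕ := fun e => min (d (Sum.inl (G.whiteEnd e))) (d (Sum.inr (G.blackEnd e)))
  have hδ : ∀ {e x}, G.IsEnd e x → δ e ≤ d x := by
    rintro e x (rfl | rfl)
    exacts [min_le_left _ _, min_le_right _ _]
  have hδ_eq : ∀ e, ∃ x, G.IsEnd e x ∧ d x = δ e := fun e => by
    obtain h | h := min_choice (d (Sum.inl (G.whiteEnd e))) (d (Sum.inr (G.blackEnd e)))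
    exacts [⟨_, .inl rfl, h.symm⟩, ⟨_, .inr rfl, h.symm⟩]
  obtain ⟨ρ, hρ, hlt⟩ := exists_injective_refinement fun e => OrderDual.toDual (δ e)
  refine ⟨ρ, hρ, fun e => ?_⟩
  obtain ⟨x, hx, hxδ⟩ := hδ_eq e
  obtain ⟨y, hxy, hy⟩ := exists_adj_dist_lt (hconn.preconnected x z) fun h => hz e (h ▸ hx)
  obtain ⟨ℓ, hmem⟩ := exists_mem_faceAt_of_adj hx hxy
  refine ⟨ℓ, fun hcl => ?_⟩
  obtain ⟨e', he'y, he'⟩ := hcl.1.1.exists_isEnd hmem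
  exact (hlt e e' ((hδ he'y).trans_lt (hy.trans_eq hxδ))).not_ge (hcl.2 e' he')

end ClosingNumber

end TensorGraph

namespace TensorGraph

variable {W B L : Type} {G : TensorGraph W B L} {e : L} {ρ : L → ℕ}

section Melopoles

variable {H S T : Set L}

theorem IsContraction.closingNumber_lt_dipoleOrder {c : Fin 4 → W ≃ B} {A : Set L}
    (h : G.IsContraction c A) (hH : ∀ e' ∈ H, ρ e' ≤ ρ e → e' = e ∨ e' ∈ A) :
    G.closingNumber ρ H e < dipoleOrder c (G.whiteEnd e) (G.blackEnd e) := by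
  have hsub : {ℓ | G.Closes ρ H e ℓ} ⊆ {ℓ | c ℓ (G.whiteEnd e) = G.blackEnd e} :=
    fun ℓ hcl => h.color_eq_blackEnd hcl.1.1 fun e' he' =>
      hH e' (hcl.1.2 e' he') (hcl.2 e' he')
  have hle : G.closingNumber ρ H e ≤ _ := Set.ncard_le_ncard hsub
  rw [dipoleOrder]
  lia

theorem IsContraction.isHeppSector {c : Fin 4 → W ≃ B} {A : Set L} {l : List L}
    (h : G.IsContraction c A) (hl : l.Pairwise fun a b => ρ a < ρ b) (hA : ∀ e ∈ A, e ∉ l)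
    (hclose : ∀ e ∈ l, 3 ≤ G.closingNumber ρ (A ∪ {a | a ∈ l}) e) : G.IsHeppSector c l := by
  induction l generalizing c A with
  | nil => trivial
  | cons e l ih =>
    obtain ⟨hfirst, hl⟩ := List.pairwise_cons.1 hl
    have heA : e ∉ A := fun he => hA e he List.mem_cons_self
    have hdipole : G.closingNumber ρ (A ∪ {a | a ∈ e :: l}) e < _ :=
      h.closingNumber_lt_dipoleOrder <| by
        rintro e' (he' | he') hle
        · exact .inr he'
        · exact .inl ((List.mem_cons.1 he').resolve_right fun hmem =>
            (hfirst e' hmem).not_ge hle)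
    refine ⟨(hclose e List.mem_cons_self).trans_lt hdipole,
      ih (h.contractLine_insert heA) hl ?_ ?_⟩
    · rintro e' (rfl | he') hmem
      · exact (hfirst e' hmem).false
      · exact hA e' he' (List.mem_cons_of_mem _ hmem)
    · intro e' he'
      have hset : insert e A ∪ {a | a ∈ l} = A ∪ {a | a ∈ e :: l} := by
        ext
        simp [or_left_comm, or_assoc]
      rw [hset]
      exact hclose e' (List.mem_cons_of_mem _ he')

/-- The set of lines `S` is a union of blocks of the incidence matrix between the lines of `H` and
its internal faces. -/
def IsUnionOfBlocks (G : TensorGraph W B L) (H S : Set L) : Prop :=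
  ∀ f, G.IsInternalFace H f → (∀ e, G.OnFace e f → e ∈ S) ∨ ∀ e, G.OnFace e f → e ∉ S

theorem IsUnionOfBlocks.isInternalFace (hS : G.IsUnionOfBlocks H S) {f : G.Face}
    (hf : G.IsInternalFace H f) (he : e ∈ S) (hon : G.OnFace e f) : G.IsInternalFace S f :=
  ⟨hf.1, (hS f hf).resolve_right fun h => h e hon he⟩

theorem IsUnionOfBlocks.trans (hS : G.IsUnionOfBlocks H S) (hT : G.IsUnionOfBlocks S T)
    (hTS : T ⊆ S) : G.IsUnionOfBlocks H T := fun f hf =>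
  (hS f hf).elim (fun h => hT f ⟨hf.1, h⟩) fun h => .inr fun e he heT => h e he (hTS heT)

theorem IsUnionOfBlocks.closingNumber_le (hS : G.IsUnionOfBlocks H S) (he : e ∈ S) :
    G.closingNumber ρ H e ≤ G.closingNumber ρ S e :=
  Set.ncard_le_ncard fun ℓ hcl => ⟨hS.isInternalFace hcl.1 he (onFace_faceAt ℓ e), hcl.2⟩

theorem IsUnionOfBlocks.exists_isConnectedSubgraph [Finite L] (hT : G.IsUnionOfBlocks H T)
    (hne : T.Nonempty) : ∃ S ⊆ T, G.IsUnionOfBlocks H S ∧ G.IsConnectedSubgraph S := by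
  obtain ⟨S, hS, hmin⟩ := (Set.toFinite
    {S | S ⊆ T ∧ S.Nonempty ∧ G.IsUnionOfBlocks H S}).exists_minimal ⟨T, subset_rfl, hne, hT⟩
  refine ⟨S, hS.1, hS.2.2, hS.2.1, fun S' hsub hne' hS' => ?_⟩
  exact hsub.antisymm (hmin ⟨hsub.trans hS.1, hne', hS.2.2.trans hS' hsub⟩ hsub)

theorem IsUnionOfBlocks.exists_isMelopole [Finite L] (hT : G.IsUnionOfBlocks H T)
    (hne : T.Nonempty) (hρ : ρ.Injective) {v : G.Bubble} (hv : ∀ e ∈ T,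
      Sum.inl (G.whiteEnd e) ∈ v.supp ∧ Sum.inr (G.blackEnd e) ∈ v.supp)
    (hclose : ∀ e ∈ T, 3 ≤ G.closingNumber ρ H e) : ∃ S, G.IsMelopole S := by
  obtain ⟨S, hST, hS, hconn⟩ := hT.exists_isConnectedSubgraph hne
  obtain ⟨l, hl, hmem⟩ := exists_list_pairwise_lt hρ S.toFinite.toFinset
  have hlS : {e | e ∈ l} = S := by
    ext e
    simpa using hmem e
  refine ⟨S, hconn, ⟨v, fun e he => hv e (hST he)⟩, l,
    hl.imp fun hlt heq => hlt.ne (congrArg ρ heq), hlS, ?_⟩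
  refine G.isContraction_empty.isHeppSector hl (by simp) fun e he => ?_
  rw [Set.empty_union, hlS]
  have heS : e ∈ S := hlS ▸ he
  exact (hclose e (hST heS)).trans (hS.closingNumber_le heS)

end Melopoles

section Bubbles

variable {H : Set L}

theorem closingNumber_eq_zero_of_crosses [Finite L] {v : G.Bubble}
    (he : ¬ (Sum.inl (G.whiteEnd e) ∈ v.supp ↔ Sum.inr (G.blackEnd e) ∈ v.supp))
    (hfirst : ∀ e' ∈ H, ρ e' ≤ ρ e → e' ≠ e →
      (Sum.inl (G.whiteEnd e') ∈ v.supp ↔ Sum.inr (G.blackEnd e') ∈ v.supp)) :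
    G.closingNumber ρ H e = 0 := by
  rw [closingNumber, Set.ncard_eq_zero, Set.eq_empty_iff_forall_notMem]
  intro ℓ hcl
  have hker : Setoid.ker (· ∈ v.supp) (Sum.inl (G.whiteEnd e)) (Sum.inr (G.blackEnd e)) :=
    rel_ends_of_isClosedFace _
      (fun w => propext ((joined_color ℓ w).mem_supp_iff (by simp) v)) hcl.1.1
      fun e' he' hne => propext (hfirst e' (hcl.1.2 e' he') (hcl.2 e' he') hne)
  exact he (iff_of_eq hker)

theorem isUnionOfBlocks_of_forall_not_crosses {v : G.Bubble} (h : ∀ e ∈ H,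
      (Sum.inl (G.whiteEnd e) ∈ v.supp ↔ Sum.inr (G.blackEnd e) ∈ v.supp)) :
    G.IsUnionOfBlocks H {e ∈ H | Sum.inl (G.whiteEnd e) ∈ v.supp} := by
  intro f hf
  refine or_iff_not_imp_right.2 fun hne => ?_
  push Not at hne
  obtain ⟨e, he, heT⟩ := hne
  refine fun e' he' => ⟨hf.2 e' he', ?_⟩
  have hker : Setoid.ker (· ∈ v.supp) (Sum.inl (G.whiteEnd e)) (Sum.inl (G.whiteEnd e')) :=
    rel_of_mem_face _ (fun w => propext ((joined_color f.1 w).mem_supp_iff (by simp) v))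
      (fun e he => propext (h e (hf.2 e he))) he he'
  exact (iff_of_eq hker).1 heT.2

/-- If a line of `H` leaves the bubble, the first one to do so closes no face. Otherwise the lines
of `H` attached to the bubble form a union of blocks, which would contain a melopole. -/
theorem FullyConvergent.exists_closingNumber_le_two [Finite L] (hG : G.FullyConvergent)
    (hρ : ρ.Injective) {v : G.Bubble} {e₀ : L} (he₀ : e₀ ∈ H)
    (hv : Sum.inl (G.whiteEnd e₀) ∈ v.supp) :
    ∃ e ∈ H, G.closingNumber ρ H e ≤ 2 ∧ ∃ x ∈ v.supp, G.IsEnd e x := by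
  let X : Set L :=
    {e ∈ H | ¬ (Sum.inl (G.whiteEnd e) ∈ v.supp ↔ Sum.inr (G.blackEnd e) ∈ v.supp)}
  obtain hX | hX := X.eq_empty_or_nonempty
  · have hcross : ∀ e ∈ H,
        (Sum.inl (G.whiteEnd e) ∈ v.supp ↔ Sum.inr (G.blackEnd e) ∈ v.supp) := fun e he =>
      by_contra fun h => Set.notMem_empty e (hX ▸ ⟨he, h⟩)
    by_contra! hclose
    obtain ⟨S, hS⟩ := (isUnionOfBlocks_of_forall_not_crosses hcross).exists_isMelopole
      ⟨e₀, he₀, hv⟩ hρ (fun e he => ⟨he.2, (hcross e he.1).1 he.2⟩) fun e he =>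
        not_le.1 fun hle => hclose e he.1 hle _ he.2 (.inl rfl)
    exact hG S hS
  · obtain ⟨e, ⟨heH, he⟩, hmin⟩ := Set.exists_min_image X ρ X.toFinite hX
    have hzero : G.closingNumber ρ H e = 0 := closingNumber_eq_zero_of_crosses he
      fun e' he' hle hne => by_contra fun h =>
        hne (hρ (hle.antisymm (hmin e' ⟨he', h⟩)))
    refine ⟨e, heH, hzero.trans_le zero_le_two, ?_⟩
    by_cases hw : Sum.inl (G.whiteEnd e) ∈ v.supp
    · exact ⟨_, hw, .inl rfl⟩
    · exact ⟨_, by_contra fun hb => he (iff_of_false hw hb), .inr rfl⟩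

theorem FullyConvergent.card_le_mul_card_closingNumber_le_two [Finite W] [Finite B]
    (hG : G.FullyConvergent) {p : ℕ} (hp : G.OrderLE p) (hρ : ρ.Injective) (H : Finset L) :
    H.card ≤ 2 * p * (H.filter fun e => G.closingNumber ρ H e ≤ 2).card := by
  classical
  have : Finite L := Finite.of_injective _ G.whiteEnd.injective
  let bubble : W ⊕ B → G.Bubble := (G.coloredPart {none}ᶜ).connectedComponentMk
  let D := H.filter fun e => G.closingNumber ρ H e ≤ 2
  have hfiber : ∀ v : G.Bubble,
      (H.filter fun e => bubble (Sum.inl (G.whiteEnd e)) = v).card ≤ p := fun v => by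
    rw [← Set.ncard_coe_finset]
    refine (Set.ncard_le_ncard_of_injOn (fun e => Sum.inl (G.whiteEnd e))
      (fun e he => (Finset.mem_filter.1 he).2) ?_ v.supp.toFinite).trans (hp v)
    exact (Sum.inl_injective.comp G.whiteEnd.injective).injOn
  have hsub : (H.image fun e => bubble (Sum.inl (G.whiteEnd e))) ⊆
      (D.image fun e => bubble (Sum.inl (G.whiteEnd e))) ∪
        D.image fun e => bubble (Sum.inr (G.blackEnd e)) := by
    refine Finset.image_subset_iff.2 fun e₀ he₀ => ?_
    obtain ⟨e, he, hle, x, hx, hend⟩ := hG.exists_closingNumber_le_two hρ (v := bubble _) he₀ rfl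
    have heD : e ∈ D := Finset.mem_filter.2 ⟨he, hle⟩
    obtain rfl | rfl := hend
    · exact Finset.mem_union_left _ (Finset.mem_image.2 ⟨e, heD, hx⟩)
    · exact Finset.mem_union_right _ (Finset.mem_image.2 ⟨e, heD, hx⟩)
  calc H.card ≤ p * (H.image fun e => bubble (Sum.inl (G.whiteEnd e))).card :=
        Finset.card_le_mul_card_image H p fun v _ => hfiber v
    _ ≤ p * (D.card + D.card) := by
        gcongr
        exact (Finset.card_le_card hsub).trans ((Finset.card_union_le _ _).trans
          (add_le_add Finset.card_image_le Finset.card_image_le))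
    _ = 2 * p * D.card := by ring

end Bubbles

end TensorGraph

namespace TensorGraph

variable {W B L : Type} {G : TensorGraph W B L} {e : L} {f : G.Face}

section Momenta

variable {ρ : L → ℕ} {H : Set L} {n : G.Face → ℝ}

/-- The space of the momenta carried by the internal faces of `H` that add up to zero along each
line. -/
def momenta (G : TensorGraph W B L) (H : Set L) : Submodule ℝ (G.Face → ℝ) where
  carrier := {n | (∀ f, ¬ G.IsInternalFace H f → n f = 0) ∧ ∀ e, ∑ ℓ, n (G.faceAt ℓ e) = 0}
  add_mem' := by
    rintro a b ⟨ha, ha'⟩ ⟨hb, hb'⟩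
    exact ⟨fun f hf => by simp [ha f hf, hb f hf], fun e => by
      simp [Finset.sum_add_distrib, ha' e, hb' e]⟩
  zero_mem' := by simp
  smul_mem' := by
    rintro c a ⟨ha, ha'⟩
    exact ⟨fun f hf => by simp [ha f hf], fun e => by simp [← Finset.mul_sum, ha' e]⟩

theorem isInternalFace_of_mem_momenta (hn : n ∈ G.momenta H) (hf : n f ≠ 0) :
    G.IsInternalFace H f :=
  by_contra fun h => hf (hn.1 f h)

/-- The faces closed by a line of `H` which also closes a face of a smaller colour. -/
def freeFaces (G : TensorGraph W B L) (ρ : L → ℕ) (H : Set L) : Set G.Face :=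
  {f | ∃ e ∈ H, G.faceAt f.1 e = f ∧ G.Closes ρ H e f.1 ∧ ∃ ℓ < f.1, G.Closes ρ H e ℓ}

/-- The last line that carries a nonzero momentum closes all faces of nonzero momentum it belongs
to. There are at least two of them, and only the one of smallest colour is not free. -/
theorem eq_zero_of_forall_mem_freeFaces [Finite L] (hn : n ∈ G.momenta H)
    (hZ : ∀ f ∈ G.freeFaces ρ H, n f = 0) : n = 0 := by
  by_contra hne
  obtain ⟨f, hf⟩ := Function.ne_iff.1 hne
  obtain ⟨e₀, he₀⟩ := (isInternalFace_of_mem_momenta hn hf).1.exists_onFace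
  obtain ⟨e, ⟨ℓ, hℓ⟩, hmax⟩ := Set.exists_max_image {e | ∃ ℓ, n (G.faceAt ℓ e) ≠ 0} ρ
    (Set.toFinite _) ⟨e₀, f.1, by rwa [onFace_iff_faceAt_eq.1 he₀]⟩
  have hcloses : ∀ ℓ, n (G.faceAt ℓ e) ≠ 0 → G.Closes ρ H e ℓ := fun ℓ hℓ =>
    ⟨isInternalFace_of_mem_momenta hn hℓ, fun e' he' =>
      hmax e' ⟨ℓ, by rwa [← onFace_iff_faceAt_eq.1 he'] at hℓ⟩⟩
  have hnot_lt : ∀ ℓ ℓ', n (G.faceAt ℓ e) ≠ 0 → n (G.faceAt ℓ' e) ≠ 0 → ¬ ℓ' < ℓ :=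
    fun ℓ ℓ' h h' hlt => h <| hZ _ ⟨e, (hcloses ℓ h).1.2 e (onFace_faceAt ℓ e), rfl,
      hcloses ℓ h, ℓ', hlt, hcloses ℓ' h'⟩
  refine hℓ ((Finset.sum_eq_single ℓ (fun ℓ' _ hne => ?_) (by simp)).symm.trans (hn.2 e))
  by_contra h
  exact hne (le_antisymm (not_lt.1 (hnot_lt ℓ' ℓ h hℓ)) (not_lt.1 (hnot_lt ℓ ℓ' hℓ h)))

theorem ncard_freeFaces_le (G : TensorGraph W B L) (ρ : L → ℕ) (H : Finset L) :
    (G.freeFaces ρ H).ncard ≤ ∑ e ∈ H, (G.closingNumber ρ H e - 1) := by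
  let free : L → Set (Fin 4) := fun e =>
    {ℓ ∈ {ℓ | G.Closes ρ H e ℓ} | ∃ ℓ' ∈ {ℓ | G.Closes ρ H e ℓ}, ℓ' < ℓ}
  have hsub : G.freeFaces ρ H ⊆ ⋃ e ∈ H, (fun ℓ => G.faceAt ℓ e) '' free e := by
    rintro f ⟨e, he, hf, hcl, ℓ, hlt, hℓ⟩
    exact Set.mem_biUnion he ⟨f.1, ⟨hcl, ℓ, hℓ, hlt⟩, hf⟩
  calc (G.freeFaces ρ H).ncard
      ≤ (⋃ e ∈ H, (fun ℓ => G.faceAt ℓ e) '' free e).ncard :=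
        Set.ncard_le_ncard hsub (H.finite_toSet.biUnion fun _ _ => Set.toFinite _)
    _ ≤ ∑ e ∈ H, ((fun ℓ => G.faceAt ℓ e) '' free e).ncard := Finset.set_ncard_biUnion_le _ _
    _ ≤ ∑ e ∈ H, (G.closingNumber ρ H e - 1) := Finset.sum_le_sum fun e _ =>
        (Set.ncard_image_le (Set.toFinite _)).trans (ncard_setOf_exists_lt_le _)

theorem IsGoodOrder.finrank_momenta_add_card_le [Finite W] [Finite B] (hρ : G.IsGoodOrder ρ)
    (H : Finset L) : Module.finrank ℝ (G.momenta H) +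
      (H.filter fun e => G.closingNumber ρ H e ≤ 2).card ≤ 2 * H.card := by
  have : Finite L := Finite.of_injective _ G.whiteEnd.injective
  have hfinrank : Module.finrank ℝ (G.momenta H) ≤ ∑ e ∈ H, (G.closingNumber ρ H e - 1) :=
    (finrank_le_ncard_of_forall_eq_zero fun _ hn hZ =>
      eq_zero_of_forall_mem_freeFaces hn hZ).trans (G.ncard_freeFaces_le ρ H)
  rw [Finset.card_filter, mul_comm, ← smul_eq_mul, ← Finset.sum_const]
  refine (Nat.add_le_add_right hfinrank _).trans ?_
  rw [← Finset.sum_add_distrib]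
  refine Finset.sum_le_sum fun e _ => ?_
  have := hρ.closingNumber_le H e
  split_ifs <;> lia

theorem IsGoodOrder.mul_finrank_momenta_add_card_le [Finite W] [Finite B] {p : ℕ}
    (hρ : G.IsGoodOrder ρ) (hG : G.FullyConvergent) (hp : G.OrderLE p) (H : Finset L) :
    2 * p * Module.finrank ℝ (G.momenta H) + H.card ≤ 4 * p * H.card := by
  have hmomenta := Nat.mul_le_mul_left (2 * p) (hρ.finrank_momenta_add_card_le H)
  have hlines := hG.card_le_mul_card_closingNumber_le_two hp hρ.injective H
  linarith

end Momenta

section Splitting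

variable {τ : G.Face → ℕ} {μ : L → ℕ}

open Classical in
/-- The incidence matrix `ε_{ef}` between faces and lines. -/
def incidence (G : TensorGraph W B L) (f : G.Face) (e : L) : ℤ :=
  if G.OnFace e f then 1 else 0

theorem sum_faceAt [Fintype G.Face] (n : G.Face → ℝ) (e : L) :
    ∑ ℓ, n (G.faceAt ℓ e) = ∑ f, n f * G.incidence f e := by
  classical
  simp only [incidence, Int.cast_ite, Int.cast_one, Int.cast_zero, mul_ite, mul_one, mul_zero,
    ← Finset.sum_filter]
  refine Finset.sum_bij (fun ℓ _ => G.faceAt ℓ e) (fun ℓ _ => ?_) (fun a _ b _ h => ?_)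
    (fun f hf => ?_) fun _ _ => rfl
  · exact Finset.mem_filter.2 ⟨Finset.mem_univ _, onFace_faceAt ℓ e⟩
  · exact congrArg Sigma.fst h
  · exact ⟨f.1, Finset.mem_univ _, onFace_iff_faceAt_eq.1 (Finset.mem_filter.1 hf).2⟩

theorem isInternalFace_univ : G.IsInternalFace Set.univ f ↔ G.IsClosedFace f :=
  and_iff_left fun _ _ => trivial

theorem linearIndependent_incidence [Finite W] [Finite B] {P : Finset G.Face}
    (hP : pivots (G.momenta Set.univ) τ ⊆ P) :
    LinearIndependent ℝ fun (f : {f // G.IsClosedFace f ∧ f ∉ P}) (e : L) =>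
      (G.incidence f e : ℝ) := by
  classical
  have := Fintype.ofFinite G.Face
  refine Fintype.linearIndependent_iff.2 fun g hg f => ?_
  let n : G.Face → ℝ := Function.extend Subtype.val g 0
  have hn_val : ∀ f, n f.1 = g f := Subtype.val_injective.extend_apply g 0
  have hn_zero : ∀ f, ¬ (G.IsClosedFace f ∧ f ∉ P) → n f = 0 :=
    fun f hf => Function.extend_apply' _ _ _ fun ⟨f', hf'⟩ => hf (hf' ▸ f'.2)
  have hn : n ∈ G.momenta Set.univ := by
    refine ⟨fun f hf => hn_zero f fun h => hf (isInternalFace_univ.2 h.1), fun e => ?_⟩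
    have hsum := congrFun hg e
    simp only [Finset.sum_apply, Pi.smul_apply, smul_eq_mul, Pi.zero_apply, ← hn_val] at hsum
    rw [sum_faceAt, ← hsum]
    refine (Fintype.sum_of_injective _ Subtype.val_injective _ _ (fun f hf => ?_)
      fun _ => rfl).symm
    rw [hn_zero f fun h => hf ⟨⟨f, h⟩, rfl⟩, zero_mul]
  rw [← hn_val]
  by_contra hne
  obtain ⟨f', hf', hnf'⟩ := exists_mem_pivots τ hn fun h => hne (congrFun h f)
  exact hnf' (hn_zero f' fun h => h.2 (hP hf'))

/-- The lowest scale of the lines of a face. -/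
def faceScale (G : TensorGraph W B L) (μ : L → ℕ) (f : G.Face) : ℕ :=
  sInf (μ '' {e | G.OnFace e f})

theorem faceScale_le (μ : L → ℕ) (h : G.OnFace e f) : G.faceScale μ f ≤ μ e :=
  Nat.sInf_le ⟨e, h, rfl⟩

theorem IsClosedFace.exists_eq_faceScale (hf : G.IsClosedFace f) (μ : L → ℕ) :
    ∃ e, G.OnFace e f ∧ μ e = G.faceScale μ f :=
  Nat.sInf_mem (Set.Nonempty.image μ hf.exists_onFace)

theorem isClosedFace_of_mem_pivots (hf : f ∈ pivots (G.momenta Set.univ) τ) : G.IsClosedFace f :=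
  let ⟨_, hn, hnf, _⟩ := hf
  (isInternalFace_of_mem_momenta hn hnf).1

theorem mem_pivots_of_lt_faceScale
    (hτ : ∀ f g, G.faceScale μ f < G.faceScale μ g → τ f < τ g)
    (hf : f ∈ pivots (G.momenta Set.univ) τ) {i : ℕ} (hi : i < G.faceScale μ f) :
    f ∈ pivots (G.momenta {e | i < μ e}) τ := by
  obtain ⟨n, hn, hnf, hzero⟩ := hf
  refine ⟨n, ⟨fun g hg => by_contra fun hng => hg ?_, hn.2⟩, hnf, hzero⟩
  refine ⟨(isInternalFace_of_mem_momenta hn hng).1, fun e he => ?_⟩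
  have hscale : G.faceScale μ f ≤ G.faceScale μ g :=
    not_lt.1 fun hlt => hng (hzero g (hτ g f hlt))
  exact hi.trans_le (hscale.trans (faceScale_le μ he))

theorem FullyConvergent.mul_sum_faceScale_add_sum_le [Finite W] [Finite B] [Fintype L]
    (hG : G.FullyConvergent) {p : ℕ} (hp : G.OrderLE p) {ρ : L → ℕ} (hρ : G.IsGoodOrder ρ)
    (hτ_inj : τ.Injective) (hτ : ∀ f g, G.faceScale μ f < G.faceScale μ g → τ f < τ g)
    {P : Finset G.Face} (hP : ↑P ⊆ pivots (G.momenta Set.univ) τ) :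
    2 * p * (∑ f ∈ P, G.faceScale μ f) + ∑ e, μ e ≤ 4 * p * ∑ e, μ e := by
  obtain ⟨N, hN⟩ : ∃ N, ∀ e, μ e ≤ N := (Set.finite_range μ).bddAbove.imp fun N hN e => hN ⟨e, rfl⟩
  have hscale : ∀ f ∈ P, G.faceScale μ f ≤ N := fun f hf => by
    obtain ⟨e, -, he⟩ := (isClosedFace_of_mem_pivots (hP hf)).exists_eq_faceScale μ
    exact he ▸ hN e
  rw [sum_eq_sum_range_card_lt P _ hscale, sum_eq_sum_range_card_lt _ μ fun e _ => hN e,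
    Finset.mul_sum, Finset.mul_sum, ← Finset.sum_add_distrib]
  refine Finset.sum_le_sum fun i _ => ?_
  refine le_trans ?_ (hρ.mul_finrank_momenta_add_card_le hG hp _)
  gcongr
  rw [← Set.ncard_coe_finset]
  refine ncard_le_finrank_of_subset_pivots hτ_inj fun f hf => ?_
  obtain ⟨hfP, hif⟩ := Finset.mem_filter.1 hf
  simpa only [Finset.coe_filter_univ] using mem_pivots_of_lt_faceScale hτ (hP hfP) hif

/-- `P` is the set of pivots of the momenta, for an order of the faces compatible with their
scales. -/
theorem FullyConvergent.exists_splitting [Finite W] [Finite B] [Fintype L]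
    (hG : G.FullyConvergent) (hconn : G.IsConnected) (hvac : ¬ G.IsVacuum) {p : ℕ}
    (hp : G.OrderLE p) (μ : L → ℕ) :
    ∃ P : Finset G.Face, (∀ f ∈ P, G.IsClosedFace f) ∧
      2 * p * (∑ f ∈ P, G.faceScale μ f) + ∑ e, μ e ≤ 4 * p * ∑ e, μ e ∧
      LinearIndependent ℝ fun (f : {f // G.IsClosedFace f ∧ f ∉ P}) (e : L) =>
        (G.incidence f e : ℝ) := by
  obtain ⟨ρ, hρ⟩ := exists_isGoodOrder hconn hvac
  obtain ⟨τ, hτ_inj, hτ⟩ := exists_injective_refinement (G.faceScale μ)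
  obtain ⟨P, hP⟩ := (pivots (G.momenta Set.univ) τ).toFinite.exists_finset_coe
  exact ⟨P, fun f hf => isClosedFace_of_mem_pivots (hP.subset hf),
    hG.mul_sum_faceScale_add_sum_le hp hρ hτ_inj hτ hP.subset,
    linearIndependent_incidence hP.symm.subset⟩

end Splitting

end TensorGraph

namespace TensorGraph

variable {W B L : Type} {G : TensorGraph W B L}

section OpenFaces

variable {ℓ : Fin 4}

/-- Along the faces of colour `ℓ`, oriented from their targets to their sources, `y` is the first
white node after `x`. -/
def Follows (G : TensorGraph W B L) (ℓ : Fin 4) (x y : W) : Prop :=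
  ∃ e, G.color ℓ x = G.blackEnd e ∧ G.whiteEnd e = y

theorem follows_rightUnique (G : TensorGraph W B L) (ℓ : Fin 4) :
    Relator.RightUnique (G.Follows ℓ) := by
  rintro x - - ⟨e, he, rfl⟩ ⟨e', he', rfl⟩
  rw [G.blackEnd.injective (he.symm.trans he')]

theorem not_follows_symm_extBlack (b : G.ExtBlack) (y : W) :
    ¬ G.Follows ℓ ((G.color ℓ).symm b.1) y := by
  rintro ⟨e, he, -⟩
  rw [Equiv.apply_symm_apply] at he
  exact b.2 ⟨e, he.symm⟩

theorem reflTransGen_follows_of_reachable {w : G.ExtWhite} {b : B}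
    (h : (G.coloredPart {none, some ℓ}).Reachable (Sum.inr b) (Sum.inl w.1)) :
    Relation.ReflTransGen (G.Follows ℓ) w.1 ((G.color ℓ).symm b) := by
  let visited : W ⊕ B → Prop := Sum.elim (Relation.ReflTransGen (G.Follows ℓ) w.1)
    fun b => Relation.ReflTransGen (G.Follows ℓ) w.1 ((G.color ℓ).symm b)
  suffices hker : Setoid.ker visited (Sum.inr b) (Sum.inl w.1) from
    (iff_of_eq hker).2 Relation.ReflTransGen.refl
  refine rel_of_reachable _ ?_ h
  rintro k (rfl | rfl) x y hj
  · obtain ⟨e, rfl, rfl⟩ := hj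
    refine propext ⟨fun hx => ?_, fun hx => hx.tail ⟨e, by simp, rfl⟩⟩
    obtain heq | ⟨y, hy, e', he', hends⟩ := Relation.ReflTransGen.cases_tail hx
    · exact absurd ⟨e, heq⟩ w.2
    · obtain rfl := G.whiteEnd.injective hends
      change Relation.ReflTransGen (G.Follows ℓ) w.1 ((G.color ℓ).symm (G.blackEnd e'))
      rwa [← (G.color ℓ).eq_symm_apply.2 he']
  · obtain rfl : G.color ℓ x = y := hj
    exact congrArg (Relation.ReflTransGen (G.Follows ℓ) w.1)
      ((G.color ℓ).symm_apply_apply x).symm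

theorem extBlack_unique {w : G.ExtWhite} {b b' : G.ExtBlack}
    (h : (G.coloredPart {none, some ℓ}).Reachable (Sum.inr b.1) (Sum.inl w.1))
    (h' : (G.coloredPart {none, some ℓ}).Reachable (Sum.inr b'.1) (Sum.inl w.1)) : b = b' := by
  have heq_of_chain : ∀ {b b' : G.ExtBlack}, Relation.ReflTransGen (G.Follows ℓ)
      ((G.color ℓ).symm b.1) ((G.color ℓ).symm b'.1) → b = b' := fun hchain =>
    hchain.cases_head.elim
      (fun heq => Subtype.ext ((G.color ℓ).symm.injective heq))
      fun ⟨_, hfollows, _⟩ => absurd hfollows (not_follows_symm_extBlack _ _)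
  obtain hchain | hchain := Relation.ReflTransGen.total_of_right_unique
    (G.follows_rightUnique ℓ) (reflTransGen_follows_of_reachable h)
    (reflTransGen_follows_of_reachable h')
  exacts [heq_of_chain hchain, (heq_of_chain hchain).symm]

variable [Fintype B] [Fintype L]

open Classical in
/-- The factor of `openKernel` that depends on the angle `t` at the target `w` of colour `ℓ`. -/
def targetKernel (G : TensorGraph W B L) (α h : L → ℝ) (g : Fin 4 × G.ExtBlack → ℝ)
    (ℓ : Fin 4) (w : G.ExtWhite) (t : ℝ) : ℝ :=
  ∏ b : G.ExtBlack,
    if (G.coloredPart {none, some ℓ}).Reachable (Sum.inr b.1) (Sum.inl w.1) ∧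
        G.color ℓ w.1 ≠ b.1
      then heatKernel (G.faceSum α (G.openFace ℓ b))
        (g (ℓ, b) + G.faceSum h (G.openFace ℓ b) - t)
      else 1

theorem targetKernel_eq_one_or_heatKernel (α h : L → ℝ) (g : Fin 4 × G.ExtBlack → ℝ)
    (ℓ : Fin 4) (w : G.ExtWhite) :
    (∀ t, G.targetKernel α h g ℓ w t = 1) ∨
      ∃ β c, ∀ t, G.targetKernel α h g ℓ w t = heatKernel β (c - t) := by
  by_cases hb : ∃ b : G.ExtBlack,
      (G.coloredPart {none, some ℓ}).Reachable (Sum.inr b.1) (Sum.inl w.1) ∧ G.color ℓ w.1 ≠ b.1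
  · obtain ⟨b, hb⟩ := hb
    refine .inr ⟨G.faceSum α (G.openFace ℓ b), g (ℓ, b) + G.faceSum h (G.openFace ℓ b),
      fun t => ?_⟩
    rw [targetKernel, Finset.prod_eq_single b
      (fun b' _ hne => if_neg fun hb' => hne (extBlack_unique hb'.1 hb.1)) (by simp), if_pos hb]
  · exact .inl fun t => Finset.prod_eq_one fun b _ => if_neg fun h' => hb ⟨b, h'⟩

theorem targetKernel_nonneg (α h : L → ℝ) (g : Fin 4 × G.ExtBlack → ℝ) (ℓ : Fin 4)
    (w : G.ExtWhite) (t : ℝ) : 0 ≤ G.targetKernel α h g ℓ w t := by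
  obtain hone | ⟨β, c, hheat⟩ := targetKernel_eq_one_or_heatKernel α h g ℓ w
  · rw [hone]
    exact zero_le_one
  · rw [hheat]
    exact heatKernel_nonneg _ _

theorem measurable_targetKernel (α h : L → ℝ) (g : Fin 4 × G.ExtBlack → ℝ) (ℓ : Fin 4)
    (w : G.ExtWhite) : Measurable (G.targetKernel α h g ℓ w) := by
  obtain hone | ⟨β, c, hheat⟩ := targetKernel_eq_one_or_heatKernel α h g ℓ w
  · rw [funext hone]
    exact measurable_const
  · rw [funext hheat]
    exact measurable_heatKernel.comp (f := fun t => (β, c - t)) (by fun_prop)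

theorem lintegral_targetKernel_le (α h : L → ℝ) (g : Fin 4 × G.ExtBlack → ℝ) (ℓ : Fin 4)
    (w : G.ExtWhite) : ∫⁻ t, ENNReal.ofReal (G.targetKernel α h g ℓ w t) ∂haarAngle ≤ 1 := by
  obtain hone | ⟨β, c, hheat⟩ := targetKernel_eq_one_or_heatKernel α h g ℓ w
  · simp [hone]
  · simpa only [hheat] using lintegral_heatKernel_sub_le β c

variable [Fintype W]

open Classical in
theorem openKernel_eq_prod_targetKernel (α h : L → ℝ) (g : G.Boundary) :
    G.openKernel α h g =
      ∏ x : Fin 4 × G.ExtWhite, G.targetKernel α h g.1 x.1 x.2 (g.2 x) := by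
  rw [openKernel, Fintype.prod_prod_type]
  exact Finset.prod_congr rfl fun ℓ _ => by
    simp only [targetKernel]
    exact Finset.prod_comm

theorem openKernel_nonneg (α h : L → ℝ) (g : G.Boundary) : 0 ≤ G.openKernel α h g := by
  rw [openKernel_eq_prod_targetKernel]
  exact Finset.prod_nonneg fun x _ => targetKernel_nonneg α h g.1 x.1 x.2 _

open Classical in
theorem lintegral_openKernel_le (α h : L → ℝ) (g : Fin 4 × G.ExtBlack → ℝ) :
    ∫⁻ g', ENNReal.ofReal (G.openKernel α h (g, g')) ∂Measure.pi (fun _ => haarAngle) ≤ 1 := by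
  have hprod : ∀ g', ENNReal.ofReal (G.openKernel α h (g, g')) =
      ∏ x : Fin 4 × G.ExtWhite, ENNReal.ofReal (G.targetKernel α h g x.1 x.2 (g' x)) :=
    fun g' => by
      rw [openKernel_eq_prod_targetKernel,
        ENNReal.ofReal_prod_of_nonneg fun x _ => targetKernel_nonneg α h g x.1 x.2 _]
  simp_rw [hprod]
  rw [lintegral_pi_prod (fun _ => haarAngle) fun x : Fin 4 × G.ExtWhite =>
    (measurable_targetKernel α h g x.1 x.2).ennreal_ofReal]
  exact Finset.prod_le_one' fun x _ => lintegral_targetKernel_le α h g x.1 x.2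

end OpenFaces

section ClosedFaces

variable [Fintype L] {f : G.Face} {α : L → ℝ}

theorem faceSum_eq_sum_incidence (x : L → ℝ) (f : G.Face) :
    G.faceSum x f = ∑ e, (G.incidence f e : ℝ) * x e := by
  classical
  simp only [faceSum, incidence, Finset.sum_filter, Int.cast_ite, Int.cast_one, Int.cast_zero,
    ite_mul, one_mul, zero_mul]

variable [Fintype W] [Fintype B]

theorem closedKernel_nonneg (α h : L → ℝ) : 0 ≤ G.closedKernel α h :=
  Finset.prod_nonneg fun _ _ => heatKernel_nonneg _ _

open Classical in
theorem ofReal_closedKernel_le {P : Finset G.Face} (hP : ∀ f ∈ P, G.IsClosedFace f)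
    {R : G.Face → ℝ} (hR : ∀ f ∈ P, ∀ θ, heatKernel (G.faceSum α f) θ ≤ R f)
    [Fintype {f // G.IsClosedFace f ∧ f ∉ P}] (h : L → ℝ) :
    ENNReal.ofReal (G.closedKernel α h) ≤ ENNReal.ofReal (∏ f ∈ P, R f) *
      ∏ f : {f // G.IsClosedFace f ∧ f ∉ P}, circleKernel (G.faceSum α f.1)
        ((∑ e, G.incidence f.1 e * h e : ℝ) : AddCircle (2 * Real.pi)) := by
  let _ := Fintype.ofFinite G.Face
  have hsub : P ⊆ Finset.univ.filter fun f => G.IsClosedFace f := fun f hf =>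
    Finset.mem_filter.2 ⟨Finset.mem_univ f, hP f hf⟩
  rw [closedKernel, ← Finset.prod_sdiff hsub, mul_comm,
    ENNReal.ofReal_mul (Finset.prod_nonneg fun _ _ => heatKernel_nonneg _ _)]
  gcongr
  · exact fun f _ => heatKernel_nonneg _ _
  · exact hR _ ‹_› _
  · rw [ENNReal.ofReal_prod_of_nonneg fun _ _ => heatKernel_nonneg _ _,
      Finset.prod_subtype (F := ‹_›) (p := fun f => G.IsClosedFace f ∧ f ∉ P) _ fun f => by simp]
    simp only [circleKernel_coe, faceSum_eq_sum_incidence, le_refl]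

theorem lintegral_closedKernel_le {P : Finset G.Face} (hP : ∀ f ∈ P, G.IsClosedFace f)
    (hind : LinearIndependent ℝ fun (f : {f // G.IsClosedFace f ∧ f ∉ P}) (e : L) =>
      (G.incidence f e : ℝ))
    {R : G.Face → ℝ} (hR : ∀ f ∈ P, ∀ θ, heatKernel (G.faceSum α f) θ ≤ R f) :
    ∫⁻ h, ENNReal.ofReal (G.closedKernel α h) ∂Measure.pi (fun _ => haarAngle) ≤
      ENNReal.ofReal (∏ f ∈ P, R f) := by
  have := Fintype.ofFinite {f // G.IsClosedFace f ∧ f ∉ P}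
  calc ∫⁻ h, ENNReal.ofReal (G.closedKernel α h) ∂Measure.pi (fun _ => haarAngle)
      ≤ _ := lintegral_mono (ofReal_closedKernel_le hP hR)
    _ = ENNReal.ofReal (∏ f ∈ P, R f) * ∏ f : {f // G.IsClosedFace f ∧ f ∉ P},
          ∫⁻ y, circleKernel (G.faceSum α f.1) y ∂AddCircle.haarAddCircle := by
        rw [lintegral_const_mul' _ _ ENNReal.ofReal_ne_top,
          lintegral_prod_sum_mul_haarAngle hind fun f => measurable_circleKernel _]
    _ ≤ ENNReal.ofReal (∏ f ∈ P, R f) :=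
        mul_le_of_le_one_right' (Finset.prod_le_one' fun f _ => lintegral_circleKernel_le _)

end ClosedFaces

section Measurability

theorem measurable_identify (G : TensorGraph W B L) : Measurable G.identify := by
  refine measurable_fst.prodMk (measurable_pi_iff.2 fun x => ?_)
  split_ifs <;> fun_prop

variable [Fintype L]

@[fun_prop]
theorem measurable_faceSum (f : G.Face) : Measurable fun x : L → ℝ => G.faceSum x f :=
  Finset.measurable_sum _ fun e _ => measurable_pi_apply e

variable [Fintype W] [Fintype B]

theorem measurable_closedKernel (G : TensorGraph W B L) :
    Measurable fun x : G.Config => G.closedKernel x.1 x.2.1 :=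
  Finset.measurable_prod _ fun f _ => measurable_heatKernel.comp
    (f := fun x : G.Config => (G.faceSum x.1 f, G.faceSum x.2.1 f)) (by fun_prop)

theorem measurable_openKernel (G : TensorGraph W B L) :
    Measurable fun x : G.Config => G.openKernel x.1 x.2.1 x.2.2 := by
  refine Finset.measurable_prod _ fun ℓ _ => Finset.measurable_prod _ fun b _ =>
    Finset.measurable_prod _ fun w _ => ?_
  split_ifs
  · exact measurable_heatKernel.comp (f := fun x : G.Config =>
      (G.faceSum x.1 (G.openFace ℓ b),
        x.2.2.1 (ℓ, b) + G.faceSum x.2.1 (G.openFace ℓ b) - x.2.2.2 (ℓ, w))) (by fun_prop)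
  · exact measurable_const

end Measurability

end TensorGraph

namespace TensorGraph

variable {W B L : Type} {G : TensorGraph W B L}

section Integrand

variable [Fintype L] {M m : ℝ} {μ : L → ℕ}

/-- The product of the mass terms of the lines with Schwinger parameters `α`. -/
def massFactor (m : ℝ) (α : L → ℝ) : ℝ :=
  ∏ e, Real.exp (-m ^ 2 * α e)

theorem massFactor_nonneg (m : ℝ) (α : L → ℝ) : 0 ≤ massFactor m α :=
  Finset.prod_nonneg fun _ _ => Real.exp_nonneg _

@[fun_prop]
theorem measurable_massFactor (m : ℝ) : Measurable (massFactor m : (L → ℝ) → ℝ) :=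
  Finset.measurable_prod _ fun e _ => by fun_prop

theorem lintegral_massFactor_le (hM : 1 ≤ M) (hm : m ≠ 0) (μ : L → ℕ) :
    ∫⁻ α, ENNReal.ofReal (massFactor m α)
        ∂Measure.pi (fun e => volume.restrict (slice M (μ e))) ≤
      ENNReal.ofReal (∏ e, ((m ^ 2)⁻¹ + M ^ 2) * ((M ^ μ e) ^ 2)⁻¹) := by
  have hint : Integrable (massFactor m) (Measure.pi fun e => volume.restrict (slice M (μ e))) :=
    Integrable.fintype_prod fun e => integrableOn_exp_slice hm M (μ e)
  rw [← ofReal_integral_eq_lintegral_ofReal hint (.of_forall (massFactor_nonneg m))]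
  refine ENNReal.ofReal_le_ofReal ?_
  calc ∫ α, massFactor m α ∂Measure.pi (fun e => volume.restrict (slice M (μ e)))
    _ = ∏ e, ∫ a in slice M (μ e), Real.exp (-m ^ 2 * a) :=
        integral_fintype_prod_eq_prod fun _ a => Real.exp (-m ^ 2 * a)
    _ ≤ ∏ e, ((m ^ 2)⁻¹ + M ^ 2) * ((M ^ μ e) ^ 2)⁻¹ :=
        Finset.prod_le_prod (fun e _ => integral_nonneg fun _ => Real.exp_nonneg _)
          fun e _ => integral_exp_slice_le hM hm (μ e)

theorem ae_mem_slice (M : ℝ) (μ : L → ℕ) :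
    ∀ᵐ α ∂Measure.pi (fun e => volume.restrict (slice M (μ e))), ∀ e, α e ∈ slice M (μ e) := by
  rw [← Measure.restrict_pi_pi]
  filter_upwards [ae_restrict_mem (.univ_pi fun e => measurableSet_slice M (μ e))] with α hα e
  exact hα e trivial

theorem heatKernel_faceSum_le (hM : 1 ≤ M) {α : L → ℝ} (hα : ∀ e, α e ∈ slice M (μ e))
    {f : G.Face} (hf : G.IsClosedFace f) (θ : ℝ) :
    heatKernel (G.faceSum α f) θ ≤ heatKernelConst * M ^ G.faceScale μ f := by
  classical
  have hM₀ : 0 < M := one_pos.trans_le hM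
  obtain ⟨e, he, hμe⟩ := hf.exists_eq_faceScale μ
  have hle : α e ≤ G.faceSum α f := Finset.single_le_sum (f := α)
    (fun e _ => (pos_of_mem_slice hM₀ (hα e)).le) (by simpa using he)
  rw [← hμe]
  refine heatKernel_le ((pos_of_mem_slice hM₀ (hα e)).trans_le hle) (one_le_pow₀ hM) ?_ θ
  exact (one_le_mul_sq_of_mem_slice hM₀ (hα e)).trans (by gcongr)

variable [Fintype W] [Fintype B]

theorem measurable_integrand (G : TensorGraph W B L) (m : ℝ) {u : G.Boundary → ℂ}
    (hu : Measurable u) : Measurable (G.integrand m u) := by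
  have hmass : Measurable fun x : G.Config => massFactor m x.1 := by fun_prop
  exact (((hmass.mul G.measurable_closedKernel).mul G.measurable_openKernel).complex_ofReal).mul
    (hu.comp (G.measurable_identify.comp (measurable_snd.comp measurable_snd)))

theorem enorm_integrand_le (m : ℝ) {u : G.Boundary → ℂ} (hu : ∀ g, ‖u g‖ ≤ 1) (x : G.Config) :
    ‖G.integrand m u x‖ₑ ≤ ENNReal.ofReal (massFactor m x.1) *
      ENNReal.ofReal (G.closedKernel x.1 x.2.1) *
        ENNReal.ofReal (G.openKernel x.1 x.2.1 x.2.2) := by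
  have hmass := massFactor_nonneg m x.1
  have hclosed := G.closedKernel_nonneg x.1 x.2.1
  have hopen := G.openKernel_nonneg x.1 x.2.1 x.2.2
  rw [← ENNReal.ofReal_mul hmass, ← ENNReal.ofReal_mul (by positivity), ← ofReal_norm, integrand,
    norm_mul, Complex.norm_real, ← massFactor, Real.norm_of_nonneg (by positivity)]
  exact ENNReal.ofReal_le_ofReal (mul_le_of_le_one_right (by positivity) (hu _))

open Classical in
theorem lintegral_enorm_integrand_le_lintegral_closedKernel (M m : ℝ) (μ : L → ℕ)
    {u : G.Boundary → ℂ} (hu : ∀ g, ‖u g‖ ≤ 1) :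
    ∫⁻ x, ‖G.integrand m u x‖ₑ ∂(G.scaleMeasure M μ) ≤
      ∫⁻ α, ENNReal.ofReal (massFactor m α) *
          ∫⁻ h, ENNReal.ofReal (G.closedKernel α h) ∂Measure.pi (fun _ => haarAngle)
        ∂Measure.pi fun e => volume.restrict (slice M (μ e)) := by
  let F : G.Config → ENNReal := fun x => ENNReal.ofReal (massFactor m x.1) *
    ENNReal.ofReal (G.closedKernel x.1 x.2.1) * ENNReal.ofReal (G.openKernel x.1 x.2.1 x.2.2)
  have hF : Measurable F := by
    have hmass : Measurable fun x : G.Config => massFactor m x.1 := by fun_prop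
    exact (hmass.ennreal_ofReal.mul G.measurable_closedKernel.ennreal_ofReal).mul
      G.measurable_openKernel.ennreal_ofReal
  calc ∫⁻ x, ‖G.integrand m u x‖ₑ ∂(G.scaleMeasure M μ)
    _ ≤ ∫⁻ x, F x ∂(G.scaleMeasure M μ) := lintegral_mono (enorm_integrand_le m hu)
    _ = ∫⁻ α, ∫⁻ h, ∫⁻ g, ∫⁻ g', F (α, h, g, g') ∂Measure.pi (fun _ => haarAngle)
            ∂Measure.pi (fun _ => haarAngle) ∂Measure.pi (fun _ => haarAngle)
          ∂Measure.pi fun e => volume.restrict (slice M (μ e)) := by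
        rw [scaleMeasure, lintegral_prod _ hF.aemeasurable]
        refine lintegral_congr fun α => ?_
        rw [lintegral_prod _ (by fun_prop)]
        refine lintegral_congr fun h => ?_
        rw [lintegral_prod _ (by fun_prop)]
    _ ≤ ∫⁻ α, ∫⁻ h, ∫⁻ _g, ENNReal.ofReal (massFactor m α) * ENNReal.ofReal (G.closedKernel α h)
            ∂Measure.pi (fun _ : Fin 4 × G.ExtBlack => haarAngle) ∂Measure.pi (fun _ => haarAngle)
          ∂Measure.pi fun e => volume.restrict (slice M (μ e)) := by
        refine lintegral_mono fun α => lintegral_mono fun h => lintegral_mono fun g => ?_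
        dsimp only [F]
        rw [lintegral_const_mul' _ _ (by finiteness)]
        exact mul_le_of_le_one_right' (lintegral_openKernel_le α h g)
    _ = _ := by
        simp_rw [lintegral_const, measure_univ, mul_one,
          lintegral_const_mul' _ _ ENNReal.ofReal_ne_top]

theorem lintegral_enorm_integrand_le (hM : 1 ≤ M) (hm : m ≠ 0) {P : Finset G.Face}
    (hP : ∀ f ∈ P, G.IsClosedFace f)
    (hind : LinearIndependent ℝ fun (f : {f // G.IsClosedFace f ∧ f ∉ P}) (e : L) =>
      (G.incidence f e : ℝ)) {u : G.Boundary → ℂ} (hu : ∀ g, ‖u g‖ ≤ 1) :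
    ∫⁻ x, ‖G.integrand m u x‖ₑ ∂(G.scaleMeasure M μ) ≤
      ENNReal.ofReal ((∏ e, ((m ^ 2)⁻¹ + M ^ 2) * ((M ^ μ e) ^ 2)⁻¹) *
        ∏ f ∈ P, heatKernelConst * M ^ G.faceScale μ f) := by
  refine (lintegral_enorm_integrand_le_lintegral_closedKernel M m μ hu).trans ?_
  calc _ ≤ ∫⁻ α, ENNReal.ofReal (massFactor m α) *
          ENNReal.ofReal (∏ f ∈ P, heatKernelConst * M ^ G.faceScale μ f)
          ∂Measure.pi fun e => volume.restrict (slice M (μ e)) := by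
        refine lintegral_mono_ae ?_
        filter_upwards [ae_mem_slice M μ] with α hα
        gcongr
        exact lintegral_closedKernel_le hP hind fun f hf =>
          heatKernel_faceSum_le hM hα (hP f hf)
    _ ≤ _ := by
        rw [lintegral_mul_const' _ _ ENNReal.ofReal_ne_top,
          ENNReal.ofReal_mul (Finset.prod_nonneg fun _ _ => by positivity)]
        gcongr
        exact lintegral_massFactor_le hM hm μ

end Integrand

section PowerCounting

variable {M m : ℝ}

theorem card_le_four_mul_of_forall_isClosedFace [Fintype L] {P : Finset G.Face}
    (hP : ∀ f ∈ P, G.IsClosedFace f) : P.card ≤ 4 * Fintype.card L := by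
  classical
  have hsub : P ⊆ Finset.univ.image fun x : Fin 4 × L => G.faceAt x.1 x.2 := fun f hf => by
    obtain ⟨e, he⟩ := (hP f hf).exists_onFace
    exact Finset.mem_image.2 ⟨(f.1, e), Finset.mem_univ _, onFace_iff_faceAt_eq.1 he⟩
  calc P.card ≤ _ := Finset.card_le_card hsub
    _ ≤ Fintype.card (Fin 4 × L) := Finset.card_image_le
    _ = 4 * Fintype.card L := by simp

/-- The constant attached to each line in the power counting: its Schwinger integral, and the heat
kernels of the four faces that run through it. -/
def lineConst (M m : ℝ) : ℝ :=
  ((m ^ 2)⁻¹ + M ^ 2) * heatKernelConst ^ 4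

/-- The factor gained per unit of scale of a line in a fully convergent graph of order `p`. -/
def scaleDecay (M : ℝ) (p : ℕ) : ℝ :=
  M ^ (-(2 * p : ℝ)⁻¹)

theorem lineConst_pos (hM : 0 < M) (m : ℝ) : 0 < lineConst M m := by
  have := two_pos.trans_le two_le_heatKernelConst
  unfold lineConst
  positivity

theorem scaleDecay_pos (hM : 0 < M) (p : ℕ) : 0 < scaleDecay M p :=
  Real.rpow_pos_of_pos hM _

theorem scaleDecay_lt_one (hM : 1 < M) {p : ℕ} (hp : p ≠ 0) : scaleDecay M p < 1 :=
  Real.rpow_lt_one_of_one_lt_of_neg hM (neg_lt_zero.2 (by positivity))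

theorem pow_mul_inv_le_scaleDecay_pow (hM : 1 ≤ M) {p a s : ℕ} (hp : p ≠ 0)
    (h : 2 * p * a + s ≤ 4 * p * s) : M ^ a * ((M ^ s) ^ 2)⁻¹ ≤ scaleDecay M p ^ s := by
  have hM₀ : 0 < M := one_pos.trans_le hM
  have hp₀ : (0 : ℝ) < 2 * p := by positivity
  have h' : (2 * p * a + s : ℝ) ≤ 4 * p * s := by exact_mod_cast h
  rw [scaleDecay, ← Real.rpow_mul_natCast hM₀.le, ← pow_mul, ← Real.rpow_natCast,
    ← Real.rpow_natCast, ← Real.rpow_neg hM₀.le, ← Real.rpow_add hM₀]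
  refine Real.rpow_le_rpow_of_exponent_le hM ?_
  push_cast
  rw [neg_mul, le_neg, inv_mul_le_iff₀ hp₀]
  linarith

variable [Fintype W] [Fintype B] [Fintype L]

theorem FullyConvergent.lintegral_enorm_integrand_le (hM : 1 ≤ M) (hm : m ≠ 0)
    (hG : G.FullyConvergent) (hconn : G.IsConnected) (hvac : ¬ G.IsVacuum) {p : ℕ} (hp₀ : p ≠ 0)
    (hp : G.OrderLE p) {u : G.Boundary → ℂ} (hu : ∀ g, ‖u g‖ ≤ 1) (μ : L → ℕ) :
    ∫⁻ x, ‖G.integrand m u x‖ₑ ∂(G.scaleMeasure M μ) ≤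
      ENNReal.ofReal (∏ e, lineConst M m * scaleDecay M p ^ μ e) := by
  have hC : 1 ≤ heatKernelConst := one_le_two.trans two_le_heatKernelConst
  obtain ⟨P, hP, hscale, hind⟩ := hG.exists_splitting hconn hvac hp μ
  refine (TensorGraph.lintegral_enorm_integrand_le hM hm hP hind hu).trans
    (ENNReal.ofReal_le_ofReal ?_)
  simp only [Finset.prod_mul_distrib, Finset.prod_const, Finset.prod_inv_distrib,
    Finset.prod_pow, Finset.prod_pow_eq_pow_sum, Finset.card_univ, lineConst]
  calc _ = ((m ^ 2)⁻¹ + M ^ 2) ^ Fintype.card L * (heatKernelConst ^ P.card *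
        (M ^ (∑ f ∈ P, G.faceScale μ f) * ((M ^ ∑ e, μ e) ^ 2)⁻¹)) := by ring
    _ ≤ ((m ^ 2)⁻¹ + M ^ 2) ^ Fintype.card L * (heatKernelConst ^ (4 * Fintype.card L) *
        scaleDecay M p ^ ∑ e, μ e) := by
        gcongr
        · exact card_le_four_mul_of_forall_isClosedFace hP
        · exact pow_mul_inv_le_scaleDecay_pow hM hp₀ hscale
    _ = _ := by ring

theorem FullyConvergent.integrable_integrand (hM : 1 ≤ M) (hm : m ≠ 0) (hG : G.FullyConvergent)
    (hconn : G.IsConnected) (hvac : ¬ G.IsVacuum) {p : ℕ} (hp₀ : p ≠ 0) (hp : G.OrderLE p)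
    {u : G.Boundary → ℂ} (hmeas : Measurable u) (hu : ∀ g, ‖u g‖ ≤ 1) (μ : L → ℕ) :
    Integrable (G.integrand m u) (G.scaleMeasure M μ) :=
  ⟨(G.measurable_integrand m hmeas).aestronglyMeasurable,
    (hG.lintegral_enorm_integrand_le hM hm hconn hvac hp₀ hp hu μ).trans_lt ENNReal.ofReal_lt_top⟩

theorem FullyConvergent.norm_amplitude_le (hM : 1 ≤ M) (hm : m ≠ 0) (hG : G.FullyConvergent)
    (hconn : G.IsConnected) (hvac : ¬ G.IsVacuum) {p : ℕ} (hp₀ : p ≠ 0) (hp : G.OrderLE p)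
    {u : G.Boundary → ℂ} (hu : ∀ g, ‖u g‖ ≤ 1) (μ : L → ℕ) :
    ‖G.amplitude M m μ u‖ ≤ ∏ e, lineConst M m * scaleDecay M p ^ μ e := by
  have hM₀ : 0 < M := one_pos.trans_le hM
  have hbound_nonneg : 0 ≤ ∏ e, lineConst M m * scaleDecay M p ^ μ e :=
    Finset.prod_nonneg fun e _ =>
      mul_nonneg (lineConst_pos hM₀ m).le (pow_nonneg (scaleDecay_pos hM₀ p).le _)
  rw [← ENNReal.ofReal_le_ofReal_iff hbound_nonneg, ofReal_norm]
  exact (enorm_integral_le_lintegral_enorm _).trans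
    (hG.lintegral_enorm_integrand_le hM hm hconn hvac hp₀ hp hu μ)

theorem FullyConvergent.sum_norm_amplitude_le (hM : 1 < M) (hm : m ≠ 0) (hG : G.FullyConvergent)
    (hconn : G.IsConnected) (hvac : ¬ G.IsVacuum) {p : ℕ} (hp₀ : p ≠ 0) (hp : G.OrderLE p)
    {u : G.Boundary → ℂ} (hu : ∀ g, ‖u g‖ ≤ 1) (s : Finset (L → ℕ)) :
    ∑ μ ∈ s, ‖G.amplitude M m μ u‖ ≤
      (lineConst M m * (1 - scaleDecay M p)⁻¹) ^ Fintype.card L := by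
  have hM₀ : 0 < M := one_pos.trans hM
  have hq₀ := (scaleDecay_pos hM₀ p).le
  have hq := scaleDecay_lt_one hM hp₀
  calc ∑ μ ∈ s, ‖G.amplitude M m μ u‖
    _ ≤ ∑ μ ∈ s, ∏ e, lineConst M m * scaleDecay M p ^ μ e :=
        Finset.sum_le_sum fun μ _ => hG.norm_amplitude_le hM.le hm hconn hvac hp₀ hp hu μ
    _ ≤ ∏ _e : L, ∑' i, lineConst M m * scaleDecay M p ^ i :=
        sum_prod_le_prod_tsum (fun _ => (summable_geometric_of_lt_one hq₀ hq).mul_left _)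
          (fun _ i => mul_nonneg (lineConst_pos hM₀ m).le (pow_nonneg hq₀ i)) s
    _ = (lineConst M m * (1 - scaleDecay M p)⁻¹) ^ Fintype.card L := by
        rw [tsum_mul_left, tsum_geometric_of_lt_one hq₀ hq, Finset.prod_const, Finset.card_univ]

end PowerCounting

end TensorGraph

end

theorem mainTheorem6 (M m : ℝ) (hM : 1 < M) (hm : 0 < m) (p : ℕ) :
    ∃ K : ℝ, 0 < K ∧
      ∀ (W B L : Type) [Fintype W] [Fintype B] [Fintype L] (G : TensorGraph W B L),
        G.IsConnected → ¬ G.IsVacuum → G.OrderLE p → G.FullyConvergent →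
        ∀ u : G.Boundary → ℂ, Measurable u → (∀ g, ‖u g‖ ≤ 1) →
          (∀ μ : L → ℕ, Integrable (G.integrand m u) (G.scaleMeasure M μ)) ∧
          Summable (fun μ : L → ℕ => ‖G.amplitude M m μ u‖) ∧
          ∑' μ : L → ℕ, ‖G.amplitude M m μ u‖ ≤ K ^ Fintype.card L := by
  have hp₀ : p + 1 ≠ 0 := p.succ_ne_zero
  have hK : 0 < TensorGraph.lineConst M m * (1 - TensorGraph.scaleDecay M (p + 1))⁻¹ :=
    mul_pos (TensorGraph.lineConst_pos (one_pos.trans hM) m)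
      (inv_pos.2 (sub_pos.2 (TensorGraph.scaleDecay_lt_one hM hp₀)))
  refine ⟨_, hK, fun W B L _ _ _ G hconn hvac hp hG u hmeas hu => ?_⟩
  have hp' : G.OrderLE (p + 1) := fun v => (hp v).trans p.le_succ
  have hsum := hG.sum_norm_amplitude_le hM hm.ne' hconn hvac hp₀ hp' hu
  exact ⟨hG.integrable_integrand hM.le hm.ne' hconn hvac hp₀ hp' hmeas hu,
    summable_of_sum_le (fun _ => norm_nonneg _) hsum,
    Real.tsum_le_of_sum_le (fun _ => norm_nonneg _) hsum⟩
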